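/- **Setting.** Let $\Omega$ be a finite set, $D:\Omega\to[0,1]$ a probability distribution and $f:\Omega\to[0,\infty)$ a function. Write $\mu=\mathbb E_{x\sim D}[f(x)]$ and $\phi=\mathbb E_{x\sim D}[f(x)^2]$. For $B\ge 1$ the pair $(D,f)$ satisfies *$B$-bounded relative variance* if $\mu>0$ and $\phi/\mu^2\le B$. A number $\hat\mu$ is an *$\varepsilon$-relative estimate* of $\mu$ if $|\mu-\hat\mu|\le\varepsilon\mu$. Let $|\psi_D\rangle=\sum_{x\in\Omega}\sqrt{D(x)}\,|x\rangle$ and $R_D=2|\psi_D\rangle\langle\psi_D|-\mathbb I$. **Algorithms.** A quantum algorithm with $m\ge 1$ copies and $T$ reflections starts in $|\psi_D\rangle^{\otimes m}\otimes|w_0\rangle$, where $w_0$ is a basis state of a finite-dimensional workspace, and applies $U_0,R_D,U_1,R_D,\dots,R_D,U_T$. Here the $U_j$ are unitaries on all registers that do not depend on $D$, and each $R_D$ (there are $T$ of them) acts, without control, on the first register $\mathbb C^\Omega$. Finally all registers except the first are measured in the computational basis, and a real number is computed from the outcome by a rule that does not depend on $D$. **Theorem.** There is a universal constant $K>0$ such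 that for every finite set $\Omega$, every $f:\Omega\to[0,\infty)$, every $B\ge 1$ and all $\varepsilon,\eta\in(0,1)$ there is a quantum algorithm $\mathcal A$ (depending on $\Omega,f,B,\varepsilon,\eta$, but not on $D$) that uses at most $16B\ln(2/\eta)+1$ copies of $|\psi_D\rangle$ and at most $$K\cdot\frac{\sqrt B}{\varepsilon}\cdot L^{1.5}\cdot\max\{1,\ln(L/\eta)\},\qquad L=\max\{1,\ln(B/\varepsilon)\},$$ invocations of the reflection $R_D$, and has the following property. For every probability distribution $D$ on $\Omega$ such that $(D,f)$ satisfies $B$-bounded relative variance, with probability at least $1-\eta$ both of the following hold: $\mathcal A$ outputs an $\varepsilon$-relative estimate of $\mathbb E_{x\sim D}[f(x)]$, and the post-measurement state of the first register is $|\psi_D\rangle$ up to a phase (one copy of $|\psi_D\rangle$ is restored). -/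

import Mathlib

namespace QMean

open scoped Kronecker Matrix

/-- The mean `E_{x ∼ D}[f(x)]`. -/
def mean {Ω : Type*} [Fintype Ω] (D f : Ω → ℝ) : ℝ := ∑ x, D x * f x

/-- The second moment `E_{x ∼ D}[f(x)²]`. -/
def secondMoment {Ω : Type*} [Fintype Ω] (D f : Ω → ℝ) : ℝ := ∑ x, D x * f x ^ 2

/-- `(D, f)` satisfies `B`-bounded relative variance: the ratio `E[f²] / E[f]²` is defined
(`f ≥ 0` has a non-zero mean) and is at most `B`. -/
def BoundedRelativeVariance {Ω : Type*} [Fintype Ω] (D f : Ω → ℝ) (B : ℝ) : Prop :=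
  0 < mean D f ∧ secondMoment D f / mean D f ^ 2 ≤ B

/-- `est` is an `ε`-relative estimate of `μ`. -/
def IsRelativeEstimate (ε μ est : ℝ) : Prop := |μ - est| ≤ ε * μ

/-- The coherent encoding `|ψ_D⟩ = ∑ₓ √D(x) |x⟩`, as the vector of its amplitudes. -/
noncomputable def coherent {Ω : Type*} (D : Ω → ℝ) : Ω → ℂ := fun x => (Real.sqrt (D x) : ℂ)

/-- The reflection `R_D = 2 |ψ_D⟩⟨ψ_D| - I`. -/
noncomputable def reflection {Ω : Type*} [DecidableEq Ω] (D : Ω → ℝ) : Matrix Ω Ω ℂ :=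
  (2 : ℂ) • Matrix.vecMulVec (coherent D) (star (coherent D)) - 1

/-- A quantum algorithm whose only access to the unknown distribution `D` on `Ω` is through copies
of `|ψ_D⟩` and invocations of `R_D`.

The registers are a working register `ℂ^Ω`, `extra` further registers `ℂ^Ω`, and a workspace with
basis `W`. All the registers `ℂ^Ω` start in `|ψ_D⟩`, the workspace in the basis state `init`. The
algorithm applies `U 0, R_D, U 1, R_D, …, R_D, U queries`, where the `U j` are unitaries on all
registers (fixed without knowledge of `D`) and `R_D` acts, without control, on the working register.
Then all registers except the working register are measured in the computational basis, and
`output` is computed from the outcome. (Intermediate measurements and adaptive choices are deferred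
to the end; the queried register is the first one because the `U j` may permute registers. Members
`U j` with `j > queries` are not used.) -/
structure ReflectionAlgorithm (Ω : Type*) [Fintype Ω] [DecidableEq Ω] where
  extra : ℕ
  W : Type
  [fintypeW : Fintype W]
  [decidableEqW : DecidableEq W]
  init : W
  queries : ℕ
  U : ℕ → Matrix.unitaryGroup (Ω × ((Fin extra → Ω) × W)) ℂ
  output : (Fin extra → Ω) × W → ℝ

attribute [instance] ReflectionAlgorithm.fintypeW ReflectionAlgorithm.decidableEqW

namespace ReflectionAlgorithm

variable {Ω : Type*} [Fintype Ω] [DecidableEq Ω] (A : ReflectionAlgorithm Ω) (D : Ω → ℝ)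

/-- The number of copies of `|ψ_D⟩` that the algorithm is given. -/
def copies : ℕ := A.extra + 1

/-- The outcomes of the final measurement. -/
abbrev Outcome : Type _ := (Fin A.extra → Ω) × A.W

/-- The initial state `|ψ_D⟩ ⊗ |ψ_D⟩^{⊗ extra} ⊗ |init⟩`. -/
noncomputable def initialState : Ω × A.Outcome → ℂ := fun s =>
  coherent D s.1 * (∏ i, coherent D (s.2.1 i)) * (if s.2.2 = A.init then 1 else 0)

/-- One invocation of `R_D`: it acts on the working register and leaves the others alone. -/
noncomputable def queryGate : Matrix (Ω × A.Outcome) (Ω × A.Outcome) ℂ :=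
  reflection D ⊗ₖ (1 : Matrix A.Outcome A.Outcome ℂ)

/-- The state after `j` invocations of `R_D` and the unitary that follows them. -/
noncomputable def stateAfter : ℕ → (Ω × A.Outcome → ℂ)
  | 0 => (A.U 0).1 *ᵥ A.initialState D
  | j + 1 => (A.U (j + 1)).1 *ᵥ (A.queryGate D *ᵥ stateAfter j)

/-- The final state, before the measurement. -/
noncomputable def finalState : Ω × A.Outcome → ℂ := A.stateAfter D A.queries

/-- The unnormalized state of the working register that is left by the measurement outcome `z`. -/
noncomputable def residual (z : A.Outcome) : Ω → ℂ := fun x => A.finalState D (x, z)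

/-- The probability of the measurement outcome `z` (Born rule). -/
noncomputable def outcomeProb (z : A.Outcome) : ℝ := ∑ x, ‖A.residual D z x‖ ^ 2

/-- After the outcome `z` the working register is exactly in the state `|ψ_D⟩`, up to a scalar. -/
def Restored (z : A.Outcome) : Prop := ∃ c : ℂ, A.residual D z = c • coherent D

open Classical in
/-- The probability that the number output by the algorithm satisfies `good` and that,
simultaneously, the working register is left in the state `|ψ_D⟩`. -/
noncomputable def successProb (good : ℝ → Prop) : ℝ :=
  ∑ z : A.Outcome, if good (A.output z) ∧ A.Restored D z then A.outcomeProb D z else 0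

end ReflectionAlgorithm

end QMean

/-!
The mean `μ = E[f]` is turned into an eigenphase. For `0 ≤ g ≤ μ` and a scale `α > 0` put
`y = α (f - g)` and let the phase gate multiply `|x⟩` by `(1 + i y x) / (1 - i y x)`. The gate
`R_D` times this phase gate has an explicit eigenvector `√D (1 - i y) / (1 + t y)` with eigenvalue
`(1 + i t) / (1 - i t)` as soon as `t` solves the secular equation `E[(y - t) / (1 + t y)] = 0`
(`reflection_mulVec_eigenvector`). If `α² E[f²] ≤ s²` with `s` small, then `E[y²] ≤ s²` and
`y ≥ -s`, so that there is a root `t` within a factor `1 + O(s²)` of `α (μ - g)`, and the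
eigenvector is within `O(s)` of `|ψ_D⟩` (`exists_eigenvector_near_coherent`). No upper bound on `f`
is needed.

Hadamard tests on a `k`-th power of the gate, started in `|ψ_D⟩`, read off the angle
`k arctan t ≈ k α (μ - g)` and disturb `|ψ_D⟩` by `O(s)` only, however large `k` and the number of
tests are (`exists_hadamard_test`). With `k α w ≈ π / 2`, a vote of `m` tests distinguishes
`μ - g < w / 16` from `μ - g > 15 w / 16` (`exists_decision`). Either answer shrinks an interval
`[g, g + w]` that contains `μ` to `15 / 16` of its length, with a left end that is still at most
`μ`, so this can be iterated. After `N = O(log (1 / ε))` rounds with `s = O(1 / N)` and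
`m = O(√N)`, the mean is known up to `ε μ` (`exists_bisection`). The numbers `k` grow
geometrically, and the last one is `O(N √B / ε)`; altogether there are `O(√B / ε · N · m)`
reflections, which is the `L ^ 1.5` of the bound.

The initial width `w`, of the order of `μ`, comes from `⌈9 B⌉` classical samples. Their mean is not
much smaller than `μ`, because the lower tail of a nonnegative variable with bounded second moment
is exponentially small, and not much larger by Markov's inequality. A run then fails with
probability at most `1 / 16` (`exists_run`).

Finally `r = ⌊log₂ (2 / η)⌋` such runs are made. Each of them uses its own `⌈9 B⌉` samples and its
own copy of `|ψ_D⟩` to work on; the used copy is exchanged with a fresh one (`exists_append_run`).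
Hence the runs are independent, and the first register ends exactly in `|ψ_D⟩`, in product with the
measured registers (`exists_independent_runs`). The median of the `r` estimates is wrong with
probability at most `2⁻ʳ ≤ η` (`exists_median_algorithm`).

Classical control and adaptive choices are modelled by unitaries that are block diagonal in the
controlling registers (`lift`). The reflection itself is never controlled: branches that need fewer
powers of the gate are padded with powers of `R_D`, which fix `|ψ_D⟩`.
-/

namespace QMean

open scoped Kronecker Matrix

set_option linter.unusedSectionVars false

section Programs

variable {Ω Z β ρ : Type*} [Fintype Ω] [DecidableEq Ω] [Fintype Z] [DecidableEq Z]
  [Fintype β] [DecidableEq β] [Fintype ρ] [DecidableEq ρ]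

/-! ### The Euclidean norm of a state -/

/-- The Euclidean norm of a vector of amplitudes. -/
noncomputable def l2 {ι : Type*} [Fintype ι] (v : ι → ℂ) : ℝ :=
  ‖(WithLp.toLp 2 v : EuclideanSpace ℂ ι)‖

lemma l2_sq {ι : Type*} [Fintype ι] (v : ι → ℂ) : l2 v ^ 2 = ∑ i, ‖v i‖ ^ 2 := by
  simp [l2, EuclideanSpace.norm_sq_eq]

lemma l2_nonneg {ι : Type*} [Fintype ι] (v : ι → ℂ) : 0 ≤ l2 v := norm_nonneg _

lemma l2_add_le {ι : Type*} [Fintype ι] (v w : ι → ℂ) : l2 (v + w) ≤ l2 v + l2 w := by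
  simpa [l2] using norm_add_le (WithLp.toLp 2 v : EuclideanSpace ℂ ι) (WithLp.toLp 2 w)

lemma l2_sub_le {ι : Type*} [Fintype ι] (v w : ι → ℂ) : l2 (v - w) ≤ l2 v + l2 w := by
  simpa [l2] using norm_sub_le (WithLp.toLp 2 v : EuclideanSpace ℂ ι) (WithLp.toLp 2 w)

lemma l2_smul {ι : Type*} [Fintype ι] (c : ℂ) (v : ι → ℂ) : l2 (c • v) = ‖c‖ * l2 v := by
  simpa [l2] using norm_smul c (WithLp.toLp 2 v : EuclideanSpace ℂ ι)

lemma l2_le_of_sq_le {ι : Type*} [Fintype ι] {v : ι → ℂ} {a : ℝ} (ha : 0 ≤ a)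
    (h : ∑ i, ‖v i‖ ^ 2 ≤ a ^ 2) : l2 v ≤ a := by
  rw [← l2_sq] at h
  exact abs_le_of_sq_le_sq' h ha |>.2

lemma l2_mulVec {ι : Type*} [Fintype ι] [DecidableEq ι] {M : Matrix ι ι ℂ}
    (hM : M ∈ Matrix.unitaryGroup ι ℂ) (v : ι → ℂ) : l2 (M *ᵥ v) = l2 v := by
  have key : ∀ w : ι → ℂ, ((l2 w ^ 2 : ℝ) : ℂ) = star w ⬝ᵥ w := by
    intro w
    rw [l2_sq, dotProduct]
    push_cast
    refine Finset.sum_congr rfl fun i _ => ?_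
    simp [← Complex.conj_mul']
  have h : ((l2 (M *ᵥ v) ^ 2 : ℝ) : ℂ) = ((l2 v ^ 2 : ℝ) : ℂ) := by
    rw [key, key, Matrix.star_mulVec, Matrix.dotProduct_mulVec, Matrix.vecMul_vecMul,
      ← Matrix.star_eq_conjTranspose, Matrix.mem_unitaryGroup_iff'.1 hM, Matrix.vecMul_one]
  have h' : l2 (M *ᵥ v) ^ 2 = l2 v ^ 2 := by exact_mod_cast h
  exact (sq_eq_sq₀ (l2_nonneg _) (l2_nonneg _)).1 h'

/-! ### The state `|ψ_D⟩` and its reflection -/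

lemma coherent_sum_sq {D : Ω → ℝ} (hD : D ∈ stdSimplex ℝ Ω) :
    ∑ x, ‖coherent D x‖ ^ 2 = 1 := by
  rw [← hD.2]
  refine Finset.sum_congr rfl fun x _ => ?_
  simp [coherent, Real.sq_sqrt (hD.1 x)]

lemma coherent_mul_self {D : Ω → ℝ} (hD : D ∈ stdSimplex ℝ Ω) (x : Ω) :
    coherent D x * coherent D x = (D x : ℂ) := by
  simp only [coherent]
  rw [← Complex.ofReal_mul, Real.mul_self_sqrt (hD.1 x)]

lemma star_coherent (D : Ω → ℝ) : star (coherent D) = coherent D := by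
  ext x; simp [coherent]

lemma reflection_mulVec (D : Ω → ℝ) (v : Ω → ℂ) :
    reflection D *ᵥ v = (2 * (coherent D ⬝ᵥ v)) • coherent D - v := by
  rw [reflection, Matrix.sub_mulVec, Matrix.one_mulVec, Matrix.smul_mulVec,
    Matrix.vecMulVec_mulVec, star_coherent]
  ext x
  simp [mul_assoc]

lemma coherent_dotProduct_self {D : Ω → ℝ} (hD : D ∈ stdSimplex ℝ Ω) :
    coherent D ⬝ᵥ coherent D = 1 := by
  rw [dotProduct, Finset.sum_congr rfl fun x _ => coherent_mul_self hD x]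
  exact_mod_cast hD.2

lemma reflection_mulVec_coherent {D : Ω → ℝ} (hD : D ∈ stdSimplex ℝ Ω) :
    reflection D *ᵥ coherent D = coherent D := by
  rw [reflection_mulVec, coherent_dotProduct_self hD]
  ext x
  simp
  ring

lemma reflection_mem_unitaryGroup {D : Ω → ℝ} (hD : D ∈ stdSimplex ℝ Ω) :
    reflection D ∈ Matrix.unitaryGroup Ω ℂ := by
  have hs : star (reflection D) = reflection D := by
    rw [reflection, Matrix.star_eq_conjTranspose, Matrix.conjTranspose_sub,
      Matrix.conjTranspose_one, Matrix.conjTranspose_smul, Matrix.conjTranspose_vecMulVec,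
      star_star, star_coherent]
    simp
  rw [Matrix.mem_unitaryGroup_iff', hs]
  refine Matrix.toLin'.injective (LinearMap.ext fun v => ?_)
  simp only [Matrix.toLin'_apply, Matrix.one_mulVec]
  rw [← Matrix.mulVec_mulVec, reflection_mulVec D v, Matrix.mulVec_sub, Matrix.mulVec_smul,
    reflection_mulVec_coherent hD, reflection_mulVec]
  simp

/-! ### Programs of unitaries and reflections -/

/-- One invocation of `R_D` on the register `Ω`, next to further registers with basis `Z`. -/
noncomputable def query (Z : Type*) [DecidableEq Z] (D : Ω → ℝ) : Matrix (Ω × Z) (Ω × Z) ℂ :=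
  reflection D ⊗ₖ (1 : Matrix Z Z ℂ)

lemma query_mem_unitaryGroup {D : Ω → ℝ} (hD : D ∈ stdSimplex ℝ Ω) :
    query Z D ∈ Matrix.unitaryGroup (Ω × Z) ℂ :=
  Matrix.kronecker_mem_unitary (reflection_mem_unitaryGroup hD) (one_mem _)

/-- The operator `Φ D` is the effect of a program that alternates `T` invocations of `R_D` on the
first register with `T + 1` unitaries which do not depend on `D`. -/
def Implements : ℕ → ((Ω → ℝ) → Matrix (Ω × Z) (Ω × Z) ℂ) → Prop
  | 0, Φ => ∃ V : Matrix.unitaryGroup (Ω × Z) ℂ, ∀ D, Φ D = V.1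
  | T + 1, Φ => ∃ (V : Matrix.unitaryGroup (Ω × Z) ℂ) (Ψ : (Ω → ℝ) → Matrix (Ω × Z) (Ω × Z) ℂ),
      Implements T Ψ ∧ ∀ D, Φ D = V.1 * (query Z D * Ψ D)

lemma Implements.of_unitary {V : Matrix (Ω × Z) (Ω × Z) ℂ}
    (hV : V ∈ Matrix.unitaryGroup (Ω × Z) ℂ) : Implements 0 (fun _ : Ω → ℝ => V) :=
  ⟨⟨V, hV⟩, fun _ => rfl⟩

lemma Implements.query : Implements 1 (fun D : Ω → ℝ => query Z D) :=
  ⟨1, fun _ => 1, Implements.of_unitary (one_mem _), fun D => by simp⟩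

lemma Implements.unitary_mul {V : Matrix (Ω × Z) (Ω × Z) ℂ}
    (hV : V ∈ Matrix.unitaryGroup (Ω × Z) ℂ) {T : ℕ}
    {Φ : (Ω → ℝ) → Matrix (Ω × Z) (Ω × Z) ℂ} (h : Implements T Φ) :
    Implements T (fun D => V * Φ D) := by
  cases T with
  | zero =>
    obtain ⟨W, hW⟩ := h
    exact ⟨⟨V, hV⟩ * W, fun D => by simp [hW]⟩
  | succ T =>
    obtain ⟨W, Ψ, hΨ, hW⟩ := h
    exact ⟨⟨V, hV⟩ * W, Ψ, hΨ, fun D => by simp [hW, mul_assoc]⟩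

lemma Implements.mul {S T : ℕ} {Φ Ψ : (Ω → ℝ) → Matrix (Ω × Z) (Ω × Z) ℂ}
    (h₂ : Implements T Ψ) (h₁ : Implements S Φ) : Implements (S + T) (fun D => Ψ D * Φ D) := by
  induction T generalizing Ψ with
  | zero =>
    obtain ⟨V, hV⟩ := h₂
    simpa [hV] using h₁.unitary_mul V.2
  | succ T ih =>
    obtain ⟨V, Ψ', hΨ', hV⟩ := h₂
    exact ⟨V, _, ih hΨ', fun D => by simp [hV, mul_assoc]⟩

lemma Implements.pow {T : ℕ} {Φ : (Ω → ℝ) → Matrix (Ω × Z) (Ω × Z) ℂ} (h : Implements T Φ)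
    (k : ℕ) : Implements (k * T) (fun D => Φ D ^ k) := by
  induction k with
  | zero => simpa using Implements.of_unitary (one_mem _)
  | succ k ih => simpa [pow_succ, add_mul, add_comm] using ih.mul h

lemma Implements.mem_unitaryGroup {T : ℕ} {Φ : (Ω → ℝ) → Matrix (Ω × Z) (Ω × Z) ℂ}
    (h : Implements T Φ) {D : Ω → ℝ} (hD : D ∈ stdSimplex ℝ Ω) :
    Φ D ∈ Matrix.unitaryGroup (Ω × Z) ℂ := by
  induction T generalizing Φ with
  | zero =>
    obtain ⟨V, hV⟩ := h
    exact hV D ▸ V.2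
  | succ T ih =>
    obtain ⟨V, Ψ, hΨ, hV⟩ := h
    exact hV D ▸ mul_mem V.2 (mul_mem (query_mem_unitaryGroup hD) (ih hΨ))

/-- A program is realized by a sequence of unitaries in the format of `ReflectionAlgorithm`. -/
lemma Implements.exists_stateAfter {e : ℕ} {W : Type} [Fintype W] [DecidableEq W] {T : ℕ}
    {Φ : (Ω → ℝ) → Matrix (Ω × ((Fin e → Ω) × W)) (Ω × ((Fin e → Ω) × W)) ℂ}
    (h : Implements T Φ) (init : W) (output : (Fin e → Ω) × W → ℝ) :
    ∃ U : ℕ → Matrix.unitaryGroup (Ω × ((Fin e → Ω) × W)) ℂ, ∀ q D,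
      (ReflectionAlgorithm.mk e W init q U output).stateAfter D T =
        Φ D *ᵥ (ReflectionAlgorithm.mk e W init q U output).initialState D := by
  induction T generalizing Φ with
  | zero =>
    obtain ⟨V, hV⟩ := h
    exact ⟨fun _ => V, fun q D => by rw [hV]; rfl⟩
  | succ T ih =>
    obtain ⟨V, Ψ, hΨ, hV⟩ := h
    obtain ⟨U, hU⟩ := ih hΨ
    have hcongr : ∀ (U' : ℕ → Matrix.unitaryGroup (Ω × ((Fin e → Ω) × W)) ℂ) (q : ℕ) D j,
        (∀ i ≤ j, U' i = U i) →
        (ReflectionAlgorithm.mk e W init q U' output).stateAfter D j =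
          (ReflectionAlgorithm.mk e W init q U output).stateAfter D j := by
      intro U' q D j
      induction j with
      | zero =>
        intro hj
        simp only [ReflectionAlgorithm.stateAfter, hj 0 le_rfl]
        rfl
      | succ j ihj =>
        intro hj
        simp only [ReflectionAlgorithm.stateAfter]
        rw [ihj fun i hi => hj i (by omega), hj (j + 1) le_rfl]
        rfl
    refine ⟨Function.update U (T + 1) V, fun q D => ?_⟩
    have h1 := hcongr (Function.update U (T + 1) V) q D T
      fun i hi => Function.update_of_ne (by omega) _ _
    simp only [ReflectionAlgorithm.stateAfter]
    rw [h1, hU q D, hV, Function.update_self, ← Matrix.mulVec_mulVec, ← Matrix.mulVec_mulVec]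
    rfl

/-! ### Classical control by further registers -/

/-- The register permutation behind a splitting `Z ≃ β × ρ` of the registers. -/
def splitEquiv (Ω : Type*) (e : Z ≃ β × ρ) : Ω × Z ≃ (Ω × β) × ρ :=
  ((Equiv.refl Ω).prodCongr e).trans (Equiv.prodAssoc Ω β ρ).symm

/-- The operator that applies `Φ c` to the registers `Ω × β` if the basis state of the control
registers `ρ` is `c`. -/
def lift (e : Z ≃ β × ρ) (Φ : ρ → Matrix (Ω × β) (Ω × β) ℂ) : Matrix (Ω × Z) (Ω × Z) ℂ :=
  (Matrix.blockDiagonal Φ).submatrix (splitEquiv Ω e) (splitEquiv Ω e)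

lemma lift_mul (e : Z ≃ β × ρ) (Φ Ψ : ρ → Matrix (Ω × β) (Ω × β) ℂ) :
    lift e (fun c => Φ c * Ψ c) = lift e Φ * lift e Ψ := by
  rw [lift, lift, lift, Matrix.submatrix_mul_equiv, Matrix.blockDiagonal_mul]

lemma lift_mem_unitaryGroup (e : Z ≃ β × ρ) {Φ : ρ → Matrix (Ω × β) (Ω × β) ℂ}
    (h : ∀ c, Φ c ∈ Matrix.unitaryGroup (Ω × β) ℂ) :
    lift e Φ ∈ Matrix.unitaryGroup (Ω × Z) ℂ := by
  have hs : star (lift e Φ) = lift e fun c => star (Φ c) := by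
    simp only [lift, Matrix.star_eq_conjTranspose, Matrix.conjTranspose_submatrix,
      Matrix.blockDiagonal_conjTranspose]
  rw [Matrix.mem_unitaryGroup_iff', hs, ← lift_mul]
  have : (fun c => star (Φ c) * Φ c) = 1 := by
    funext c
    exact Matrix.mem_unitaryGroup_iff'.1 (h c)
  rw [this, lift, Matrix.blockDiagonal_one, Matrix.submatrix_one_equiv]

lemma lift_query (e : Z ≃ β × ρ) (D : Ω → ℝ) : lift e (fun _ => query β D) = query Z D := by
  ext ⟨x, z⟩ ⟨x', z'⟩
  have : z = z' ↔ (e z).2 = (e z').2 ∧ (e z).1 = (e z').1 := by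
    rw [← e.injective.eq_iff, Prod.ext_iff, and_comm]
  simp only [lift, splitEquiv, query, Matrix.submatrix_apply, Matrix.blockDiagonal_apply,
    Matrix.kroneckerMap_apply, Matrix.one_apply, Equiv.trans_apply, Equiv.prodCongr_apply,
    Prod.map_apply, Equiv.refl_apply, Equiv.prodAssoc_symm_apply, this]
  split_ifs <;> simp_all

lemma Implements.lift (e : Z ≃ β × ρ) {T : ℕ} {Φ : ρ → (Ω → ℝ) → Matrix (Ω × β) (Ω × β) ℂ}
    (h : ∀ c, Implements T (Φ c)) : Implements T (fun D => lift e fun c => Φ c D) := by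
  induction T generalizing Φ with
  | zero =>
    choose V hV using h
    exact ⟨⟨QMean.lift e fun c => (V c).1, lift_mem_unitaryGroup e fun c => (V c).2⟩,
      fun D => by simp [hV]⟩
  | succ T ih =>
    choose V Ψ hΨ hV using h
    refine ⟨⟨QMean.lift e fun c => (V c).1, lift_mem_unitaryGroup e fun c => (V c).2⟩, _, ih hΨ,
      fun D => ?_⟩
    simp only [hV]
    rw [lift_mul, lift_mul, lift_query]

/-- A controlled operator acts branch by branch. -/
lemma lift_mulVec (e : Z ≃ β × ρ) (Φ : ρ → Matrix (Ω × β) (Ω × β) ℂ) (v : Ω × Z → ℂ)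
    (p : Ω × Z) : (lift e Φ *ᵥ v) p =
      (Φ (e p.2).2 *ᵥ fun q => v (q.1, e.symm (q.2, (e p.2).2))) (p.1, (e p.2).1) := by
  rw [lift, Matrix.submatrix_mulVec_equiv]
  simp only [Function.comp_apply, splitEquiv, Equiv.trans_apply, Equiv.prodCongr_apply,
    Equiv.prodAssoc_symm_apply, Matrix.mulVec, dotProduct]
  rw [Fintype.sum_prod_type_right, Finset.sum_eq_single (e p.2).2]
  · refine Finset.sum_congr rfl fun q _ => ?_
    simp [Matrix.blockDiagonal_apply]
  · intro c _ hc
    refine Finset.sum_eq_zero fun q _ => ?_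
    simp [Matrix.blockDiagonal_apply, hc.symm]
  · simp

end Programs

section Eigenvector

variable {Ω : Type*} [Fintype Ω] [DecidableEq Ω]

/-! ### An eigenvector close to `|ψ_D⟩` -/

/-- The point `(1 + i y) / (1 - i y) = exp (2 i arctan y)` of the unit circle. -/
noncomputable def phase (y : ℝ) : ℂ := (1 + y * Complex.I) / (1 - y * Complex.I)

lemma one_sub_mul_I_ne_zero (y : ℝ) : (1 - y * Complex.I : ℂ) ≠ 0 := by
  intro h
  simpa using congrArg Complex.re h

lemma phase_eq_exp (y : ℝ) :
    phase y = Complex.exp ((2 * Real.arctan y : ℝ) * Complex.I) := by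
  have hs : 0 < √(1 + y ^ 2) := by positivity
  have h2 : (√(1 + y ^ 2)) ^ 2 = 1 + y ^ 2 := Real.sq_sqrt (by positivity)
  have h : Complex.exp ((Real.arctan y : ℝ) * Complex.I) =
      (1 + y * Complex.I) / (√(1 + y ^ 2) : ℝ) := by
    rw [Complex.exp_mul_I, ← Complex.ofReal_cos, ← Complex.ofReal_sin, Real.cos_arctan,
      Real.sin_arctan]
    push_cast
    ring
  have hc : ((√(1 + y ^ 2) : ℝ) : ℂ) ^ 2 = (1 + y * Complex.I) * (1 - y * Complex.I) := by
    rw [← Complex.ofReal_pow, h2]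
    push_cast
    ring_nf
    simp
  have h0 : (1 + y * Complex.I : ℂ) ≠ 0 := by
    intro h
    simpa using congrArg Complex.re h
  have e : ((2 * Real.arctan y : ℝ) * Complex.I : ℂ) =
    (Real.arctan y : ℝ) * Complex.I + (Real.arctan y : ℝ) * Complex.I := by push_cast; ring
  rw [e, Complex.exp_add, h, div_mul_div_comm, ← sq ((√(1 + y ^ 2) : ℝ) : ℂ), hc, phase]
  field_simp [one_sub_mul_I_ne_zero y]

lemma norm_phase (y : ℝ) : ‖phase y‖ = 1 := by
  rw [phase_eq_exp, Complex.norm_exp_ofReal_mul_I]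

/-- The secular equation: a root `t` of `E[(y - t) / (1 + t y)] = 0` gives the explicit eigenvector
`√D (1 - i y) / (1 + t y)` of `R_D diag(phase y)`, with eigenvalue `phase t`. -/
lemma reflection_mulVec_eigenvector {D : Ω → ℝ} (hD : D ∈ stdSimplex ℝ Ω) {y : Ω → ℝ} {t : ℝ}
    (hpos : ∀ x, 0 < 1 + t * y x) (hroot : ∑ x, D x * ((y x - t) / (1 + t * y x)) = 0) :
    reflection D *ᵥ (fun x => phase (y x) *
        (coherent D x * ((1 - y x * Complex.I) / (1 + t * y x)))) =
      phase t • fun x => coherent D x * ((1 - y x * Complex.I) / (1 + t * y x)) := by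
  -- the secular equation `b = t a` and `E[(1 + t y) / (1 + t y)] = 1` determine `a` and `b`
  set a := ∑ x, D x * (1 / (1 + t * y x)) with ha
  set b := ∑ x, D x * (y x / (1 + t * y x)) with hb
  have h1 : b - t * a = 0 := by
    rw [← hroot, ha, hb, Finset.mul_sum, ← Finset.sum_sub_distrib]
    exact Finset.sum_congr rfl fun x _ => by ring
  have h2 : a + t * b = 1 := by
    rw [← hD.2, ha, hb, Finset.mul_sum, ← Finset.sum_add_distrib]
    refine Finset.sum_congr rfl fun x _ => ?_
    field_simp [(hpos x).ne']
  have ht : (1 + t ^ 2) ≠ 0 := by positivity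
  have ha' : a = 1 / (1 + t ^ 2) := by
    rw [eq_div_iff ht]
    linear_combination h2 - t * h1
  have hb' : b = t / (1 + t ^ 2) := by
    rw [eq_div_iff ht]
    linear_combination t * h2 + h1
  have hne : ∀ x, (1 + t * y x : ℂ) ≠ 0 := fun x => by exact_mod_cast (hpos x).ne'
  have hE : ∀ x, phase (y x) * (coherent D x * ((1 - y x * Complex.I) / (1 + t * y x))) =
      coherent D x * ((1 + y x * Complex.I) / (1 + t * y x)) := fun x => by
    rw [phase]
    field_simp [one_sub_mul_I_ne_zero (y x), hne x]
  have hdot : (coherent D ⬝ᵥ fun x => coherent D x * ((1 + y x * Complex.I) / (1 + t * y x))) =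
      1 / (1 - t * Complex.I) := by
    have : ∀ x, coherent D x * (coherent D x * ((1 + y x * Complex.I) / (1 + t * y x))) =
        ((D x * (1 / (1 + t * y x)) : ℝ) : ℂ) +
          ((D x * (y x / (1 + t * y x)) : ℝ) : ℂ) * Complex.I := fun x => by
      rw [← mul_assoc, coherent_mul_self hD]
      push_cast
      ring
    simp only [dotProduct, this]
    rw [Finset.sum_add_distrib, ← Finset.sum_mul, ← Complex.ofReal_sum, ← Complex.ofReal_sum,
      ← ha, ← hb, ha', hb']
    have ht' : (1 + t ^ 2 : ℂ) ≠ 0 := by exact_mod_cast ht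
    push_cast
    field_simp [one_sub_mul_I_ne_zero t]
    ring_nf
    simp
  simp only [hE]
  rw [reflection_mulVec, hdot]
  ext x
  simp only [Pi.sub_apply, Pi.smul_apply, smul_eq_mul, phase]
  field_simp [one_sub_mul_I_ne_zero t, hne x]
  ring_nf
  simp
  ring

/-- If `y` is bounded below by `-s` and has second moment at most `s²`, then the secular equation
has a root close to `E[y]`, up to a factor `1 + O(s²)`. -/
lemma exists_secular_root {D : Ω → ℝ} (hD : D ∈ stdSimplex ℝ Ω) {y : Ω → ℝ} {s : ℝ}
    (hs : s ≤ 1 / 10) (hy : ∀ x, -s ≤ y x) (hmean : 0 ≤ ∑ x, D x * y x)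
    (hsq : ∑ x, D x * y x ^ 2 ≤ s ^ 2) (hs0 : 0 ≤ s) :
    ∃ t, 0 ≤ t ∧ t ≤ 2 * s ∧ ∑ x, D x * ((y x - t) / (1 + t * y x)) = 0 ∧
      t ≤ (∑ x, D x * y x) * (1 + 4 * s ^ 2) ∧ (∑ x, D x * y x) ≤ t * (1 + 7 * s ^ 2) := by
  set d := ∑ x, D x * y x with hd
  have hds : d ≤ s := by
    refine abs_le_of_sq_le_sq' ?_ hs0 |>.2
    refine le_trans ?_ hsq
    have := Finset.sum_nonneg fun x (_ : x ∈ Finset.univ) =>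
      mul_nonneg (hD.1 x) (sq_nonneg (y x - d))
    have e : ∑ x, D x * (y x - d) ^ 2 = ∑ x, D x * y x ^ 2 - 2 * d * d + d ^ 2 := by
      have : ∀ x, D x * (y x - d) ^ 2 = D x * y x ^ 2 - 2 * d * (D x * y x) + D x * d ^ 2 :=
        fun x => by ring
      simp only [this, Finset.sum_add_distrib, Finset.sum_sub_distrib, ← Finset.mul_sum,
        ← Finset.sum_mul]
      rw [hD.2, ← hd]
      ring
    nlinarith
  have hden : ∀ t, 0 ≤ t → t ≤ 2 * s → ∀ x, 1 / 2 ≤ 1 + t * y x := fun t h0 h1 x => by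
    nlinarith [mul_le_mul_of_nonneg_left (hy x) h0, mul_nonneg h0 hs0]
  -- `F(t) = E[y] - t - t E[(y - t) y / (1 + t y)]`
  have hF : ∀ t, 0 ≤ t → t ≤ 2 * s → ∑ x, D x * ((y x - t) / (1 + t * y x)) =
      d - t - t * ∑ x, D x * ((y x - t) * y x / (1 + t * y x)) := by
    intro t h0 h1
    have : d - t = ∑ x, D x * (y x - t) := by
      simp only [mul_sub, Finset.sum_sub_distrib, ← Finset.sum_mul, hD.2, ← hd, one_mul]
    rw [this, Finset.mul_sum, ← Finset.sum_sub_distrib]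
    refine Finset.sum_congr rfl fun x _ => ?_
    have := hden t h0 h1 x
    have h' : (1 + t * y x) * (1 + t * y x)⁻¹ = 1 := mul_inv_cancel₀ (by linarith)
    linear_combination D x * (y x - t) * h'
  have hlow : ∀ t, 0 ≤ t → t ≤ 2 * s →
      -(t ^ 2 / 2) ≤ ∑ x, D x * ((y x - t) * y x / (1 + t * y x)) := by
    intro t h0 h1
    have : -(t ^ 2 / 2) = ∑ x, D x * -(t ^ 2 / 2) := by rw [← Finset.sum_mul, hD.2, one_mul]
    rw [this]
    refine Finset.sum_le_sum fun x _ => mul_le_mul_of_nonneg_left ?_ (hD.1 x)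
    have := hden t h0 h1 x
    rw [le_div_iff₀ (by linarith)]
    nlinarith [sq_nonneg (2 * y x - t), sq_nonneg t]
  have hup : ∀ t, 0 ≤ t → t ≤ 2 * s →
      ∑ x, D x * ((y x - t) * y x / (1 + t * y x)) ≤ 3 * s ^ 2 + t ^ 2 := by
    intro t h0 h1
    have : ∑ x, D x * ((y x - t) * y x / (1 + t * y x)) ≤ ∑ x, D x * (3 * y x ^ 2 + t ^ 2) := by
      refine Finset.sum_le_sum fun x _ => mul_le_mul_of_nonneg_left ?_ (hD.1 x)
      have := hden t h0 h1 x
      rw [div_le_iff₀ (by linarith)]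
      nlinarith [sq_nonneg (y x + t), sq_nonneg (y x), sq_nonneg t,
        mul_le_mul_of_nonneg_left this (by positivity : 0 ≤ 3 * y x ^ 2 + t ^ 2)]
    refine this.trans ?_
    simp only [mul_add, Finset.sum_add_distrib, ← Finset.sum_mul, hD.2]
    have : ∑ x, D x * (3 * y x ^ 2) = 3 * ∑ x, D x * y x ^ 2 := by
      rw [Finset.mul_sum]; exact Finset.sum_congr rfl fun x _ => by ring
    rw [this]
    linarith
  have hcont : ContinuousOn (fun t => ∑ x, D x * ((y x - t) / (1 + t * y x)))
      (Set.Icc 0 (2 * d)) := by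
    refine continuousOn_finsetSum _ fun x _ => ContinuousOn.mul continuousOn_const
      (ContinuousOn.div (by fun_prop) (by fun_prop) fun t ht => ?_)
    have := hden t ht.1 (by linarith [ht.2]) x
    linarith
  have hF0 : 0 ≤ ∑ x, D x * ((y x - 0) / (1 + 0 * y x)) := by simpa using hmean
  have hF1 : ∑ x, D x * ((y x - 2 * d) / (1 + 2 * d * y x)) ≤ 0 := by
    rw [hF (2 * d) (by linarith) (by linarith)]
    have h4 : d ^ 2 ≤ 1 / 100 := by nlinarith
    nlinarith [mul_le_mul_of_nonneg_left (hlow (2 * d) (by linarith) (by linarith)) hmean]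
  obtain ⟨t, ht, hroot⟩ := intermediate_value_Icc' (by linarith : (0 : ℝ) ≤ 2 * d) hcont
    ⟨hF1, hF0⟩
  have hts : t ≤ 2 * s := by linarith [ht.2]
  have hroot' : ∑ x, D x * ((y x - t) / (1 + t * y x)) = 0 := hroot
  have heq := hF t ht.1 hts
  rw [hroot'] at heq
  refine ⟨t, ht.1, hts, hroot', ?_, ?_⟩
  · have h1 := mul_le_mul_of_nonneg_left (hlow t ht.1 hts) ht.1
    have h3 : t ^ 3 ≤ 8 * d * s ^ 2 := by
      have : t ^ 3 = t * t ^ 2 := by ring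
      rw [this]
      nlinarith [mul_le_mul ht.2 (pow_le_pow_left₀ ht.1 hts 2) (by positivity) (by linarith)]
    nlinarith
  · have h1 := mul_le_mul_of_nonneg_left (hup t ht.1 hts) ht.1
    have h3 : t ^ 2 ≤ 4 * s ^ 2 := by nlinarith [pow_le_pow_left₀ ht.1 hts 2]
    nlinarith [mul_le_mul_of_nonneg_left h3 ht.1]

/-- The gate `R_D diag(phase y)` has an eigenvector `v` near `|ψ_D⟩` whose eigenphase is almost
`2 arctan E[y]`. -/
lemma exists_eigenvector_near_coherent {D : Ω → ℝ} (hD : D ∈ stdSimplex ℝ Ω) {y : Ω → ℝ} {s : ℝ}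
    (hs : s ≤ 1 / 10) (hy : ∀ x, -s ≤ y x) (hmean : 0 ≤ ∑ x, D x * y x)
    (hsq : ∑ x, D x * y x ^ 2 ≤ s ^ 2) (hs0 : 0 ≤ s) :
    ∃ t, 0 ≤ t ∧ t ≤ 2 * s ∧
      t ≤ (∑ x, D x * y x) * (1 + 4 * s ^ 2) ∧ (∑ x, D x * y x) ≤ t * (1 + 7 * s ^ 2) ∧
      ∃ v : Ω → ℂ, l2 (coherent D - v) ≤ 3 * s ∧
        (reflection D * Matrix.diagonal fun x => phase (y x)) *ᵥ v = phase t • v := by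
  obtain ⟨t, ht0, hts, hroot, h1, h2⟩ := exists_secular_root hD hs hy hmean hsq hs0
  have hden : ∀ x, 1 / 2 ≤ 1 + t * y x := fun x => by
    nlinarith [mul_le_mul_of_nonneg_left (hy x) ht0, mul_nonneg ht0 hs0]
  refine ⟨t, ht0, hts, h1, h2, fun x => coherent D x * ((1 - y x * Complex.I) / (1 + t * y x)),
    l2_le_of_sq_le (by linarith) ?_, ?_⟩
  · have : ∀ x, ‖(coherent D - fun x => coherent D x * ((1 - y x * Complex.I) / (1 + t * y x))) x‖
        ^ 2 ≤ D x * (5 * y x ^ 2) := by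
      intro x
      have hne : (1 + t * y x : ℂ) ≠ 0 := by
        have : (1 + t * y x : ℝ) ≠ 0 := by linarith [hden x]
        exact_mod_cast this
      have e : (coherent D - fun x => coherent D x * ((1 - y x * Complex.I) / (1 + t * y x))) x =
          coherent D x * (y x * (t + Complex.I) / ((1 + t * y x : ℝ) : ℂ)) := by
        simp only [Pi.sub_apply]
        push_cast
        linear_combination -coherent D x * mul_inv_cancel₀ hne
      have ht : ‖(t + Complex.I : ℂ)‖ ^ 2 = t ^ 2 + 1 := by
        rw [← Complex.normSq_eq_norm_sq, Complex.normSq_apply]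
        simp
        ring
      have hc : ‖coherent D x‖ ^ 2 = D x := by
        simp [coherent, Real.sq_sqrt (hD.1 x)]
      rw [e, norm_mul, norm_div, norm_mul, mul_pow, div_pow, mul_pow, ht, hc, Complex.norm_real,
        Complex.norm_real, Real.norm_eq_abs, Real.norm_eq_abs, sq_abs, sq_abs]
      refine mul_le_mul_of_nonneg_left ?_ (hD.1 x)
      have h4 : (1 / 2 : ℝ) ^ 2 ≤ (1 + t * y x) ^ 2 := pow_le_pow_left₀ (by norm_num) (hden x) 2
      rw [div_le_iff₀ (by positivity)]
      have h5 : t ^ 2 ≤ 1 / 25 := by nlinarith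
      nlinarith [mul_le_mul_of_nonneg_left h4 (sq_nonneg (y x)),
        mul_le_mul_of_nonneg_left h5 (sq_nonneg (y x))]
    refine (Finset.sum_le_sum fun x _ => this x).trans ?_
    have e : ∑ x, D x * (5 * y x ^ 2) = 5 * ∑ x, D x * y x ^ 2 := by
      rw [Finset.mul_sum]; exact Finset.sum_congr rfl fun x _ => by ring
    rw [e]
    nlinarith [sq_nonneg s]
  · rw [← Matrix.mulVec_mulVec]
    have := reflection_mulVec_eigenvector hD (fun x => by linarith [hden x]) hroot
    rw [← this]
    congr 1
    ext x
    rw [Matrix.mulVec_diagonal]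

end Eigenvector

section Test

variable {Ω : Type*} [Fintype Ω] [DecidableEq Ω]

/-! ### A controlled phase test -/

lemma sum_prod_bool {R : Type*} [CommSemiring R] {m : ℕ} (f : Fin m → Bool → R) :
    ∑ c : Fin m → Bool, ∏ i, f i (c i) = ∏ i, ∑ b, f i b := by
  rw [Finset.prod_univ_sum, Fintype.piFinset_univ]

/-- If each of `m` independent trials is bad with probability at most `1/16`, then at least half of
them are bad with probability at most `2⁻ᵐ`: the expectation of `16 ^ #bad` is at most `2 ^ m`, and
`16 ^ #bad` is at least `4 ^ m` when half of the trials are bad. -/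
lemma sum_majority_le {m : ℕ} {p : Bool → ℝ} (hp : ∀ b, 0 ≤ p b) (h1 : p true + p false = 1)
    {bad : Bool} (hbad : p bad ≤ 1 / 16) :
    ∑ c : Fin m → Bool, (if m ≤ 2 * (Finset.univ.filter fun i => c i = bad).card
      then ∏ i, p (c i) else 0) ≤ (1 / 2) ^ m := by
  have key : ∀ c : Fin m → Bool, (if m ≤ 2 * (Finset.univ.filter fun i => c i = bad).card
      then ∏ i, p (c i) else 0) ≤
        (1 / 4) ^ m * ∏ i, (p (c i) * if c i = bad then 16 else 1) := by
    intro c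
    have hnn : 0 ≤ ∏ i, p (c i) := Finset.prod_nonneg fun i _ => hp _
    rw [Finset.prod_mul_distrib, Finset.prod_ite, Finset.prod_const, Finset.prod_const_one, mul_one]
    split_ifs with h
    · have : (4 : ℝ) ^ m ≤ 16 ^ (Finset.univ.filter fun i => c i = bad).card := by
        rw [show (16 : ℝ) = 4 ^ 2 by norm_num, ← pow_mul]
        exact pow_le_pow_right₀ (by norm_num) h
      have h4 : (1 / 4 : ℝ) ^ m * 4 ^ m = 1 := by rw [← mul_pow]; norm_num
      calc ∏ i, p (c i) = ((1 / 4 : ℝ) ^ m * 4 ^ m) * ∏ i, p (c i) := by rw [h4, one_mul]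
        _ = (1 / 4 : ℝ) ^ m * ((∏ i, p (c i)) * 4 ^ m) := by ring
        _ ≤ _ := by gcongr
    · positivity
  refine (Finset.sum_le_sum fun c _ => key c).trans ?_
  rw [← Finset.mul_sum]
  rw [sum_prod_bool fun (_ : Fin m) b => p b * if b = bad then (16 : ℝ) else 1, Finset.prod_const,
    Finset.card_univ, Fintype.card_fin, ← mul_pow]
  refine pow_le_pow_left₀ ?_ ?_ _
  · have := hp true
    have := hp false
    cases bad <;> simp <;> positivity
  · cases bad <;> simp <;> linarith

/-- The Hadamard transform on a register of `m` qubits. -/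
noncomputable def hadamard (m : ℕ) : Matrix (Fin m → Bool) (Fin m → Bool) ℂ := fun b c =>
  ∏ i, (if b i ∧ c i then -1 else 1) * ((√2)⁻¹ : ℝ)

lemma inv_sqrt_two_mul_self : (((√2)⁻¹ : ℝ) : ℂ) * ((√2)⁻¹ : ℝ) = 1 / 2 := by
  rw [← Complex.ofReal_mul, ← mul_inv, Real.mul_self_sqrt (by norm_num)]
  push_cast
  norm_num

lemma hadamard_mem_unitaryGroup (m : ℕ) : hadamard m ∈ Matrix.unitaryGroup (Fin m → Bool) ℂ := by
  rw [Matrix.mem_unitaryGroup_iff]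
  ext b b'
  simp only [Matrix.mul_apply, Matrix.star_apply, hadamard, star_prod]
  set F : Fin m → Bool → ℂ := fun i x => (if b i ∧ x then (-1 : ℂ) else 1) *
    (if b' i ∧ x then (-1 : ℂ) else 1) * (1 / 2) with hF
  have e : ∀ c : Fin m → Bool,
      (∏ i, (if b i ∧ c i then (-1 : ℂ) else 1) * ((√2)⁻¹ : ℝ)) *
        ∏ i, star ((if b' i ∧ c i then (-1 : ℂ) else 1) * ((√2)⁻¹ : ℝ)) = ∏ i, F i (c i) := by
    intro c
    rw [← Finset.prod_mul_distrib]
    refine Finset.prod_congr rfl fun i _ => ?_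
    rw [hF, ← inv_sqrt_two_mul_self]
    have : star ((if b' i ∧ c i then (-1 : ℂ) else 1) * (((√2)⁻¹ : ℝ) : ℂ)) =
        (if b' i ∧ c i then (-1 : ℂ) else 1) * (((√2)⁻¹ : ℝ) : ℂ) := by
      split_ifs <;> simp
    rw [this]
    ring
  rw [Finset.sum_congr rfl fun c _ => e c, sum_prod_bool, Matrix.one_apply]
  split_ifs with h
  · subst h
    refine Finset.prod_eq_one fun i _ => ?_
    cases hb : b i
    · simp [hF, hb]
    · simp [hF, hb]
      norm_num
  · obtain ⟨i, hi⟩ := Function.ne_iff.1 h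
    refine Finset.prod_eq_zero (Finset.mem_univ i) ?_
    revert hi
    cases hb : b i <;> cases hb' : b' i <;> simp [hF, hb, hb']

lemma one_kronecker_mulVec {C : Type*} [Fintype C] [DecidableEq C] (H : Matrix C C ℂ)
    (w : Ω → ℂ) (a : C → ℂ) :
    ((1 : Matrix Ω Ω ℂ) ⊗ₖ H) *ᵥ (fun p => w p.1 * a p.2) = fun p => w p.1 * (H *ᵥ a) p.2 := by
  ext ⟨x, c⟩
  simp only [Matrix.mulVec, dotProduct, Matrix.kroneckerMap_apply, Fintype.sum_prod_type,
    Matrix.one_apply]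
  rw [Finset.sum_eq_single x]
  · rw [Finset.mul_sum]
    exact Finset.sum_congr rfl fun c' _ => by simp; ring
  · intro x' _ hx
    simp [hx.symm]
  · simp

lemma kronecker_one_mulVec_unit (A : Matrix Ω Ω ℂ) (v : Ω × Unit → ℂ) (p : Ω × Unit) :
    ((A ⊗ₖ (1 : Matrix Unit Unit ℂ)) *ᵥ v) p = (A *ᵥ fun x => v (x, ())) p.1 := by
  simp [Matrix.mulVec, dotProduct, Matrix.kroneckerMap_apply, Fintype.sum_prod_type]

lemma kronecker_one_pow (A : Matrix Ω Ω ℂ) (n : ℕ) :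
    (A ⊗ₖ (1 : Matrix Unit Unit ℂ)) ^ n = (A ^ n) ⊗ₖ (1 : Matrix Unit Unit ℂ) := by
  induction n with
  | zero => simp
  | succ n ih => rw [pow_succ, ih, ← Matrix.mul_kronecker_mul, one_mul, pow_succ]

lemma diagonal_mem_unitaryGroup {φ : Ω → ℂ} (hφ : ∀ x, ‖φ x‖ = 1) :
    Matrix.diagonal φ ∈ Matrix.unitaryGroup Ω ℂ := by
  rw [Matrix.mem_unitaryGroup_iff, Matrix.star_eq_conjTranspose, Matrix.diagonal_conjTranspose,
    Matrix.diagonal_mul_diagonal, ← Matrix.diagonal_one]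
  congr 1
  ext x
  simp [Complex.mul_conj', hφ x]

/-- The number of uses of the phase gate may be controlled by a register, although `R_D` itself is
applied the same number of times in all branches: the missing ones are made up for by powers of
`R_D` alone. -/
lemma exists_controlled_power {C : Type*} [Fintype C] [DecidableEq C] {φ : Ω → ℂ}
    (hφ : ∀ x, ‖φ x‖ = 1) {T : ℕ} {l : C → ℕ} (hl : ∀ c, l c ≤ T) :
    ∃ Φ : (Ω → ℝ) → Matrix (Ω × C) (Ω × C) ℂ, Implements T Φ ∧ ∀ D v p,
      (Φ D *ᵥ v) p = ((reflection D ^ (T - l p.2) *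
        (reflection D * Matrix.diagonal φ) ^ l p.2) *ᵥ fun x => v (x, p.2)) p.1 := by
  have hE : Matrix.diagonal φ ⊗ₖ (1 : Matrix Unit Unit ℂ) ∈ Matrix.unitaryGroup (Ω × Unit) ℂ :=
    Matrix.kronecker_mem_unitary (diagonal_mem_unitaryGroup hφ) (one_mem _)
  have hloc : ∀ c, Implements T (fun D : Ω → ℝ =>
      query Unit D ^ (T - l c) * (query Unit D * Matrix.diagonal φ ⊗ₖ 1) ^ l c) := by
    intro c
    have h := ((Implements.query (Ω := Ω) (Z := Unit)).pow (T - l c)).mul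
      ((Implements.query.mul (Implements.of_unitary hE)).pow (l c))
    have e : l c * (0 + 1) + (T - l c) * 1 = T := by have := hl c; omega
    rwa [e] at h
  refine ⟨_, Implements.lift (Equiv.uniqueProd C Unit).symm hloc, fun D v p => ?_⟩
  rw [lift_mulVec]
  simp only [query]
  rw [← Matrix.mul_kronecker_mul, one_mul, kronecker_one_pow, kronecker_one_pow,
    ← Matrix.mul_kronecker_mul, one_mul, kronecker_one_mulVec_unit]
  rfl

lemma l2_pow_mulVec {ι : Type*} [Fintype ι] [DecidableEq ι] {M : Matrix ι ι ℂ}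
    (hM : M ∈ Matrix.unitaryGroup ι ℂ) (n : ℕ) (v : ι → ℂ) : l2 (M ^ n *ᵥ v) = l2 v :=
  l2_mulVec (pow_mem hM n) v

lemma pow_mulVec_eigenvector {ι : Type*} [Fintype ι] [DecidableEq ι] {M : Matrix ι ι ℂ} {c : ℂ}
    {v : ι → ℂ} (h : M *ᵥ v = c • v) (n : ℕ) : M ^ n *ᵥ v = c ^ n • v := by
  induction n with
  | zero => simp
  | succ n ih => rw [pow_succ, ← Matrix.mulVec_mulVec, h, Matrix.mulVec_smul, ih, smul_smul,
      pow_succ']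

/-- The Hadamard test, on `m` qubits at once, of the `k`-th power of a gate `R_D diag(φ)` with an
eigenvector near `|ψ_D⟩`: it acts on `|ψ_D⟩` almost as if this were the eigenvector. The error does
not grow with `m` and `k`. -/
lemma exists_hadamard_test {φ : Ω → ℂ} (hφ : ∀ x, ‖φ x‖ = 1) (m k : ℕ) :
    ∃ Φ : (Ω → ℝ) → Matrix (Ω × (Fin m → Bool)) (Ω × (Fin m → Bool)) ℂ, Implements (m * k) Φ ∧
      ∀ D ∈ stdSimplex ℝ Ω, ∀ (ev : ℂ) (v : Ω → ℂ) (δ : ℝ), ‖ev‖ = 1 →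
        l2 (coherent D - v) ≤ δ → (reflection D * Matrix.diagonal φ) *ᵥ v = ev • v →
        l2 (Φ D *ᵥ (fun p => coherent D p.1 * if p.2 = (fun _ => false) then 1 else 0) -
          fun p => coherent D p.1 * ∏ i, (1 + (if p.2 i then -1 else 1) * ev ^ k) / 2) ≤ 2 * δ := by
  set cnt : (Fin m → Bool) → ℕ := fun c => ∑ i, if c i then 1 else 0 with hcnt
  have hcntm : ∀ c, k * cnt c ≤ m * k := fun c => by
    rw [mul_comm m k]
    refine Nat.mul_le_mul_left k ?_
    calc cnt c ≤ ∑ _i : Fin m, 1 := Finset.sum_le_sum fun i _ => by split_ifs <;> omega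
      _ = m := by simp
  have hH : (1 : Matrix Ω Ω ℂ) ⊗ₖ hadamard m ∈ Matrix.unitaryGroup (Ω × (Fin m → Bool)) ℂ :=
    Matrix.kronecker_mem_unitary (one_mem _) (hadamard_mem_unitaryGroup m)
  obtain ⟨P, hP, hPv⟩ := exists_controlled_power hφ hcntm
  have hI := ((Implements.of_unitary hH).mul hP).mul (Implements.of_unitary hH)
  rw [zero_add, add_zero] at hI
  refine ⟨_, hI, fun D hD ev v δ hev hδ hv => ?_⟩
  set RE := reflection D * Matrix.diagonal φ with hRE
  have hREu : RE ∈ Matrix.unitaryGroup Ω ℂ :=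
    mul_mem (reflection_mem_unitaryGroup hD) (diagonal_mem_unitaryGroup hφ)
  set A : (Fin m → Bool) → Matrix Ω Ω ℂ := fun c =>
    reflection D ^ (m * k - k * cnt c) * RE ^ (k * cnt c) with hA
  have hAc : ∀ c, l2 (A c *ᵥ coherent D - ev ^ (k * cnt c) • coherent D) ≤ 2 * δ := by
    intro c
    -- the padding by powers of `R_D` does not move `|ψ_D⟩`
    have h1 : reflection D ^ (m * k - k * cnt c) *ᵥ coherent D = coherent D := by
      have := pow_mulVec_eigenvector (c := 1) (v := coherent D)
        (by rw [reflection_mulVec_coherent hD, one_smul]) (m * k - k * cnt c)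
      rwa [one_pow, one_smul] at this
    have e : A c *ᵥ coherent D - ev ^ (k * cnt c) • coherent D =
        reflection D ^ (m * k - k * cnt c) *ᵥ (RE ^ (k * cnt c) *ᵥ (coherent D - v) -
          ev ^ (k * cnt c) • (coherent D - v)) := by
      rw [Matrix.mulVec_sub (RE ^ _), pow_mulVec_eigenvector hv, smul_sub, Matrix.mulVec_sub,
        Matrix.mulVec_sub, Matrix.mulVec_sub, Matrix.mulVec_smul _ _ (coherent D), h1, hA,
        ← Matrix.mulVec_mulVec]
      abel
    rw [e, l2_pow_mulVec (reflection_mem_unitaryGroup hD)]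
    refine (l2_sub_le _ _).trans ?_
    rw [l2_pow_mulVec hREu, l2_smul, norm_pow, hev, one_pow, one_mul]
    linarith
  set e0 : (Fin m → Bool) → ℂ := fun c => if c = (fun _ => false) then 1 else 0 with he0
  set u := hadamard m *ᵥ e0 with hu
  have hu' : ∀ c, u c = ∏ _i : Fin m, (((√2)⁻¹ : ℝ) : ℂ) := by
    intro c
    simp [hu, he0, Matrix.mulVec, dotProduct, hadamard]
  have hu1 : ∑ c, ‖u c‖ ^ 2 = 1 := by
    rw [← l2_sq, hu, l2_mulVec (hadamard_mem_unitaryGroup m), l2_sq,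
      Finset.sum_eq_single (fun _ => false)]
    · simp [he0]
    · intro c _ hc
      simp [he0, hc]
    · simp
  have hHg : hadamard m *ᵥ (fun c => u c * ev ^ (k * cnt c)) =
      fun b => ∏ i, (1 + (if b i then -1 else 1) * ev ^ k) / 2 := by
    ext b
    set F : Fin m → Bool → ℂ := fun i x => (if b i ∧ x then (-1 : ℂ) else 1) * (1 / 2) *
      (if x then ev ^ k else 1) with hF
    have e : ∀ c : Fin m → Bool, hadamard m b c * (u c * ev ^ (k * cnt c)) =
        ∏ i, F i (c i) := by
      intro c
      have hpow : ev ^ (k * cnt c) = ∏ i, if c i then ev ^ k else 1 := by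
        rw [hcnt, pow_mul, ← Finset.prod_pow_eq_pow_sum]
        exact Finset.prod_congr rfl fun i _ => by split_ifs <;> simp
      rw [hadamard, hu', hpow, ← Finset.prod_mul_distrib, ← Finset.prod_mul_distrib]
      refine Finset.prod_congr rfl fun i _ => ?_
      rw [hF, ← inv_sqrt_two_mul_self]
      ring
    simp only [Matrix.mulVec, dotProduct]
    rw [Finset.sum_congr rfl fun c _ => e c, sum_prod_bool]
    refine Finset.prod_congr rfl fun i _ => ?_
    cases hb : b i <;> simp [hF, hb] <;> ring_nf
  set err : Ω × (Fin m → Bool) → ℂ := fun p =>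
    u p.2 * (A p.2 *ᵥ coherent D - ev ^ (k * cnt p.2) • coherent D) p.1 with herr
  have hPu : P D *ᵥ (fun p => coherent D p.1 * u p.2) =
      (fun p => coherent D p.1 * (u p.2 * ev ^ (k * cnt p.2))) + err := by
    ext p
    have : (fun x => coherent D x * u p.2) = u p.2 • coherent D := by
      ext x
      simp [mul_comm]
    rw [hPv, this, Matrix.mulVec_smul]
    simp only [herr, Pi.add_apply, Pi.smul_apply, Pi.sub_apply, smul_eq_mul, hA]
    ring
  have he : (fun p : Ω × (Fin m → Bool) =>
      coherent D p.1 * if p.2 = (fun _ => false) then (1 : ℂ) else 0) =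
        fun p => coherent D p.1 * e0 p.2 := rfl
  rw [← Matrix.mulVec_mulVec, ← Matrix.mulVec_mulVec, he, one_kronecker_mulVec, ← hu, hPu,
    Matrix.mulVec_add, one_kronecker_mulVec _ _ fun c => u c * ev ^ (k * cnt c), hHg,
    add_sub_cancel_left, l2_mulVec hH]
  have hδ0 : 0 ≤ δ := (l2_nonneg _).trans hδ
  refine l2_le_of_sq_le (by linarith) ?_
  calc ∑ p, ‖err p‖ ^ 2
      = ∑ c, ‖u c‖ ^ 2 * l2 (A c *ᵥ coherent D - ev ^ (k * cnt c) • coherent D) ^ 2 := by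
        rw [Fintype.sum_prod_type_right]
        refine Finset.sum_congr rfl fun c _ => ?_
        rw [l2_sq, Finset.mul_sum]
        exact Finset.sum_congr rfl fun x _ => by rw [herr, norm_mul, mul_pow]
    _ ≤ ∑ c, ‖u c‖ ^ 2 * (2 * δ) ^ 2 := by
        refine Finset.sum_le_sum fun c _ => mul_le_mul_of_nonneg_left ?_ (sq_nonneg _)
        exact pow_le_pow_left₀ (l2_nonneg _) (hAc c) 2
    _ = (2 * δ) ^ 2 := by rw [← Finset.sum_mul, hu1, one_mul]

lemma norm_one_add_exp_div_two (a : ℝ) :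
    ‖(1 + Complex.exp ((2 * a : ℝ) * Complex.I)) / 2‖ ^ 2 = Real.cos a ^ 2 ∧
      ‖(1 - Complex.exp ((2 * a : ℝ) * Complex.I)) / 2‖ ^ 2 = Real.sin a ^ 2 := by
  rw [Complex.exp_mul_I, ← Complex.ofReal_cos, ← Complex.ofReal_sin, ← Complex.normSq_eq_norm_sq,
    ← Complex.normSq_eq_norm_sq, Complex.normSq_div, Complex.normSq_div, Complex.normSq_apply,
    Complex.normSq_apply, Complex.normSq_apply]
  have h1 := Real.sin_sq_add_cos_sq a
  have h2 := Real.sin_sq_add_cos_sq (2 * a)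
  have h3 := Real.cos_two_mul a
  generalize Real.cos (2 * a) = c at *
  generalize Real.sin (2 * a) = c' at *
  constructor
  · simp
    nlinarith
  · simp
    nlinarith

lemma arctan_le_self {t : ℝ} (ht : 0 ≤ t) : Real.arctan t ≤ t := by
  have := Real.le_tan (Real.arctan_nonneg.2 ht) (Real.arctan_lt_pi_div_two t)
  rwa [Real.tan_arctan] at this

lemma le_arctan_mul {t : ℝ} (ht : 0 ≤ t) : t ≤ Real.arctan t * (1 + t ^ 2) := by
  have h := Real.sin_le (Real.arctan_nonneg.2 ht)
  have h1 : (1 : ℝ) ≤ √(1 + t ^ 2) := Real.one_le_sqrt.2 (by nlinarith [sq_nonneg t])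
  have h2 : √(1 + t ^ 2) ≤ 1 + t ^ 2 := by
    nlinarith [Real.sq_sqrt (show (0 : ℝ) ≤ 1 + t ^ 2 by positivity)]
  rw [Real.sin_arctan, div_le_iff₀ (by linarith)] at h
  exact h.trans (mul_le_mul_of_nonneg_left h2 (Real.arctan_nonneg.2 ht))

/-- If `t` is close to `d` and `k x` is close to `π / 2`, then the rotation angle `k arctan t` is
close to `0` when `d` is much smaller than `x`, and close to `π / 2` when `d` is close to `x`. -/
lemma decision_angle {k x d t s : ℝ} (hk : 0 ≤ k) (ht0 : 0 ≤ t) (hts : t ≤ 2 * s) (hs : s ≤ 1 / 10)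
    (ht1 : t ≤ d * (1 + 4 * s ^ 2)) (ht2 : d ≤ t * (1 + 7 * s ^ 2))
    (hk1 : Real.pi / 2 ≤ k * x) (hk2 : k * x ≤ Real.pi / 2 + 1 / 10) (hd : 0 ≤ d) (hdx : d ≤ x) :
    (d < x / 16 → Real.sin (k * Real.arctan t) ^ 2 ≤ 1 / 16) ∧
      (15 * x / 16 < d → Real.cos (k * Real.arctan t) ^ 2 ≤ 1 / 16) := by
  have hss : s ^ 2 ≤ 1 / 100 := by nlinarith
  have htt : t ^ 2 ≤ 1 / 25 := by nlinarith
  have hpi := Real.pi_lt_d2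
  have hpi' := Real.pi_gt_d2
  have hθ0 : 0 ≤ k * Real.arctan t := mul_nonneg hk (Real.arctan_nonneg.2 ht0)
  have hkt : k * Real.arctan t ≤ k * t := mul_le_mul_of_nonneg_left (arctan_le_self ht0) hk
  have hkt' : k * t ≤ k * Real.arctan t * (26 / 25) := by
    have h1 := mul_le_mul_of_nonneg_left (le_arctan_mul ht0) hk
    have h2 := mul_le_mul_of_nonneg_left htt hθ0
    linarith
  have hkd : k * t ≤ k * d * (26 / 25) := by
    have h1 := mul_le_mul_of_nonneg_left ht1 hk
    have h2 := mul_le_mul_of_nonneg_left hss (mul_nonneg hk hd)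
    linarith
  have hkd' : k * d ≤ k * t * (107 / 100) := by
    have h1 := mul_le_mul_of_nonneg_left ht2 hk
    have h2 := mul_le_mul_of_nonneg_left hss (mul_nonneg hk ht0)
    linarith
  constructor
  · intro h
    have h1 := mul_le_mul_of_nonneg_left h.le hk
    have h3 := Real.sin_le hθ0
    have h4 := Real.sin_nonneg_of_nonneg_of_le_pi hθ0 (by linarith)
    calc Real.sin (k * Real.arctan t) ^ 2 ≤ (1 / 4) ^ 2 := pow_le_pow_left₀ h4 (by linarith) 2
      _ = 1 / 16 := by norm_num
  · intro h
    have h1 := mul_le_mul_of_nonneg_left h.le hk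
    have h2 := mul_le_mul_of_nonneg_left hdx hk
    have h7 : Real.cos (k * Real.arctan t) = -Real.sin (k * Real.arctan t - Real.pi / 2) := by
      rw [Real.sin_sub_pi_div_two, neg_neg]
    have h9 : |k * Real.arctan t - Real.pi / 2| ≤ 1 / 4 := abs_le.2 ⟨by linarith, by linarith⟩
    rw [h7, neg_sq, ← sq_abs]
    calc |Real.sin (k * Real.arctan t - Real.pi / 2)| ^ 2 ≤ (1 / 4) ^ 2 :=
          pow_le_pow_left₀ (abs_nonneg _) (Real.abs_sin_le_abs.trans h9) 2
      _ = 1 / 16 := by norm_num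

/-- At least half of the qubits of a test register read `true`. -/
def majority {m : ℕ} (c : Fin m → Bool) : Prop :=
  m ≤ 2 * (Finset.univ.filter fun i => c i = true).card

instance {m : ℕ} (c : Fin m → Bool) : Decidable (majority c) := by
  unfold majority; infer_instance

lemma two_mul_card_false_of_not_majority {m : ℕ} {c : Fin m → Bool} (h : ¬ majority c) :
    m ≤ 2 * (Finset.univ.filter fun i => c i = false).card := by
  have := Finset.card_filter_add_card_filter_not (s := (Finset.univ : Finset (Fin m)))
    (fun i => c i = true)
  simp only [Bool.not_eq_true, Finset.card_univ, Fintype.card_fin] at this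
  unfold majority at h
  omega

/-- The decision step of the bisection. Given a lower bound `g` on the mean and an upper bound
`g + w`, a program with `m k` queries decides whether the mean exceeds `g + w / 16` or is less than
`g + 15 w / 16`, and almost leaves the register in `|ψ_D⟩`. -/
lemma exists_decision (f : Ω → ℝ) (α g w : ℝ) (m k : ℕ) :
    ∃ Φ : (Ω → ℝ) → Matrix (Ω × (Fin m → Bool)) (Ω × (Fin m → Bool)) ℂ, Implements (m * k) Φ ∧
      ∀ D ∈ stdSimplex ℝ Ω, ∀ s, s ≤ 1 / 10 → (∀ x, 0 ≤ f x) → 0 < α → 0 ≤ g → g ≤ mean D f →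
        mean D f ≤ g + w → α * mean D f ≤ s → α ^ 2 * secondMoment D f ≤ s ^ 2 →
        Real.pi / 2 ≤ k * (α * w) → k * (α * w) ≤ Real.pi / 2 + 1 / 10 →
        ∃ a : (Fin m → Bool) → ℂ, ∑ c, ‖a c‖ ^ 2 = 1 ∧
          ∑ c, (if (majority c ∧ mean D f < g + w / 16) ∨
            (¬ majority c ∧ g + 15 * w / 16 < mean D f) then ‖a c‖ ^ 2 else 0) ≤ (1 / 2) ^ m ∧
          l2 (Φ D *ᵥ (fun p => coherent D p.1 * if p.2 = (fun _ => false) then 1 else 0) -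
            fun p => coherent D p.1 * a p.2) ≤ 6 * s := by
  obtain ⟨Φ, hΦ, hT⟩ := exists_hadamard_test (fun x => norm_phase (α * (f x - g))) m k
  refine ⟨Φ, hΦ, fun D hD s hs hf hα hg hgμ hμw hαμ hαφ hk1 hk2 => ?_⟩
  set μ := mean D f with hμ
  have hμ0 : 0 ≤ μ := hg.trans hgμ
  have hs0 : 0 ≤ s := (mul_nonneg hα.le hμ0).trans hαμ
  have hmean : ∑ x, D x * (α * (f x - g)) = α * (μ - g) := by
    have : ∀ x, D x * (α * (f x - g)) = α * (D x * f x) - D x * (α * g) := fun x => by ring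
    simp only [this, Finset.sum_sub_distrib, ← Finset.mul_sum, ← Finset.sum_mul, hD.2]
    rw [hμ, mean]
    ring
  -- recentring does not increase the second moment, as `g² ≤ 2 g μ` for `0 ≤ g ≤ μ`
  have hsq : ∑ x, D x * (α * (f x - g)) ^ 2 ≤ s ^ 2 := by
    have : ∀ x, D x * (α * (f x - g)) ^ 2 =
      α ^ 2 * (D x * f x ^ 2) - 2 * α ^ 2 * g * (D x * f x) + D x * (α ^ 2 * g ^ 2) :=
        fun x => by ring
    simp only [this, Finset.sum_add_distrib, Finset.sum_sub_distrib, ← Finset.mul_sum,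
      ← Finset.sum_mul, hD.2]
    have h1 : ∑ x, D x * f x = μ := rfl
    have h2 : ∑ x, D x * f x ^ 2 = secondMoment D f := rfl
    rw [h1, h2]
    nlinarith [mul_nonneg (sq_nonneg α) (mul_nonneg hg (sub_nonneg.2 hgμ)),
      mul_nonneg (sq_nonneg α) (mul_nonneg hg hμ0)]
  have hlow : ∀ x, -s ≤ α * (f x - g) := fun x => by
    nlinarith [mul_nonneg hα.le (hf x), mul_le_mul_of_nonneg_left hgμ hα.le]
  obtain ⟨t, ht0, hts, ht1, ht2, v, hv, hev⟩ := exists_eigenvector_near_coherent hD hs hlow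
    (by rw [hmean]; exact mul_nonneg hα.le (by linarith)) hsq hs0
  rw [hmean] at ht1 ht2
  set θ := (k : ℝ) * Real.arctan t with hθ
  have hpow : phase t ^ k = Complex.exp ((2 * θ : ℝ) * Complex.I) := by
    rw [phase_eq_exp, ← Complex.exp_nat_mul, hθ]
    push_cast
    ring_nf
  set p : Bool → ℝ := fun b => if b then Real.sin θ ^ 2 else Real.cos θ ^ 2 with hp
  have hp0 : ∀ b, 0 ≤ p b := fun b => by
    simp only [hp]
    split_ifs <;> positivity
  have hp1 : p true + p false = 1 := by simp [hp]
  have hnorm : ∀ c : Fin m → Bool,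
      ‖∏ i, (1 + (if c i then -1 else 1) * phase t ^ k) / 2‖ ^ 2 = ∏ i, p (c i) := by
    intro c
    rw [norm_prod, ← Finset.prod_pow]
    refine Finset.prod_congr rfl fun i _ => ?_
    have := norm_one_add_exp_div_two θ
    rw [hpow]
    cases c i
    · simpa [hp] using this.1
    · simpa [hp, sub_eq_add_neg] using this.2
  refine ⟨fun c => ∏ i, (1 + (if c i then -1 else 1) * phase t ^ k) / 2, ?_, ?_,
    (hT D hD _ v (3 * s) (norm_phase t) hv hev).trans (by linarith)⟩
  · simp only [hnorm]
    rw [sum_prod_bool fun (_ : Fin m) b => p b]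
    simp [hp1]
  · simp only [hnorm]
    have hk0 : (0 : ℝ) ≤ k := Nat.cast_nonneg k
    obtain ⟨hsin, hcos⟩ := decision_angle hk0 ht0 hts hs ht1 ht2 hk1 hk2
      (mul_nonneg hα.le (by linarith)) (mul_le_mul_of_nonneg_left (by linarith) hα.le)
    by_cases hsmall : μ < g + w / 16
    · have hbad : p true ≤ 1 / 16 := by
        simp only [hp, if_true]
        exact hsin (by nlinarith)
      refine le_trans (Finset.sum_le_sum fun c _ => ?_) (sum_majority_le hp0 hp1 hbad)
      have hnn : 0 ≤ ∏ i, p (c i) := Finset.prod_nonneg fun i _ => hp0 _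
      by_cases hc : majority c
      · rw [if_pos (Or.inl ⟨hc, hsmall⟩)]
        unfold majority at hc
        rw [if_pos hc]
      · have hw : ¬ g + 15 * w / 16 < μ := by
          have : 0 ≤ w := by linarith
          linarith
        rw [if_neg (by rintro (⟨h, -⟩ | ⟨-, h⟩); exacts [hc h, hw h])]
        split_ifs <;> simp [hnn]
    · by_cases hbig : g + 15 * w / 16 < μ
      · have hbad : p false ≤ 1 / 16 := by
          simp only [hp, Bool.false_eq_true, if_false]
          exact hcos (by nlinarith)
        refine le_trans (Finset.sum_le_sum fun c _ => ?_) (sum_majority_le hp0 hp1 hbad)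
        have hnn : 0 ≤ ∏ i, p (c i) := Finset.prod_nonneg fun i _ => hp0 _
        by_cases hc : majority c
        · rw [if_neg (by rintro (⟨-, h⟩ | ⟨h, -⟩); exacts [hsmall h, h hc])]
          split_ifs <;> simp [hnn]
        · rw [if_pos (Or.inr ⟨hc, hbig⟩), if_pos (two_mul_card_false_of_not_majority hc)]
      · refine le_trans (le_of_eq (Finset.sum_eq_zero fun c _ => ?_)) (by positivity)
        rw [if_neg (by rintro (⟨-, h⟩ | ⟨-, h⟩); exacts [hsmall h, hbig h])]

end Test

section Bisection

variable {Ω : Type*} [Fintype Ω] [DecidableEq Ω]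

/-! ### Bisection -/

lemma l2_coherent_mul {Z : Type*} [Fintype Z] {D : Ω → ℝ} (hD : D ∈ stdSimplex ℝ Ω) (a : Z → ℂ) :
    l2 (fun p : Ω × Z => coherent D p.1 * a p.2) ^ 2 = ∑ z, ‖a z‖ ^ 2 := by
  rw [l2_sq, Fintype.sum_prod_type_right]
  refine Finset.sum_congr rfl fun z _ => ?_
  simp only [norm_mul, mul_pow]
  rw [← Finset.sum_mul, coherent_sum_sq hD, one_mul]

/-- Sequential composition of programs that almost preserve `|ψ⟩`: if `Φ` writes a record `h` with
amplitude `a h` and `Θ h`, which is controlled by this record, writes `c` with amplitude `b h c`,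
then the errors add up. -/
lemma l2_lift_mul_lift_sub_le {H C : Type*} [Fintype H] [DecidableEq H] [Fintype C] [DecidableEq C]
    {ψ : Ω → ℂ} {Φ : Matrix (Ω × H) (Ω × H) ℂ} {Θ : H → Matrix (Ω × C) (Ω × C) ℂ}
    (hΘ : ∀ h, Θ h ∈ Matrix.unitaryGroup (Ω × C) ℂ) {h₀ : H} {c₀ : C} {a : H → ℂ}
    {b : H → C → ℂ} {δ₁ δ₂ : ℝ} (ha : ∑ h, ‖a h‖ ^ 2 ≤ 1) (hδ₂ : 0 ≤ δ₂)
    (h₁ : l2 (Φ *ᵥ (fun p => ψ p.1 * if p.2 = h₀ then 1 else 0) - fun p => ψ p.1 * a p.2) ≤ δ₁)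
    (h₂ : ∀ h, a h ≠ 0 →
      l2 (Θ h *ᵥ (fun p => ψ p.1 * if p.2 = c₀ then 1 else 0) - fun p => ψ p.1 * b h p.2) ≤ δ₂) :
    l2 ((lift (Equiv.prodComm H C) Θ * lift (Equiv.refl (H × C)) fun _ => Φ) *ᵥ
        (fun p => ψ p.1 * if p.2 = (h₀, c₀) then 1 else 0) -
      fun p => ψ p.1 * (a p.2.1 * b p.2.1 p.2.2)) ≤ δ₁ + δ₂ := by
  set L₁ := lift (Equiv.refl (H × C)) (fun _ => Φ) with hL₁
  set L₂ := lift (Equiv.prodComm H C) Θ with hL₂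
  set v₀ : Ω × (H × C) → ℂ := fun p => ψ p.1 * if p.2 = (h₀, c₀) then 1 else 0 with hv₀
  set u : Ω × (H × C) → ℂ := fun p => ψ p.1 * a p.2.1 * if p.2.2 = c₀ then 1 else 0 with hu
  set u' : Ω × (H × C) → ℂ := fun p => ψ p.1 * (a p.2.1 * b p.2.1 p.2.2) with hu'
  have hL₂u : L₂ ∈ Matrix.unitaryGroup (Ω × (H × C)) ℂ := lift_mem_unitaryGroup _ hΘ
  have e₁ : l2 (L₁ *ᵥ v₀ - u) ≤ δ₁ := by
    refine le_trans (le_of_eq ?_) h₁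
    rw [← sq_eq_sq₀ (l2_nonneg _) (l2_nonneg _), l2_sq, l2_sq, Fintype.sum_prod_type,
      Fintype.sum_prod_type]
    refine Finset.sum_congr rfl fun x _ => ?_
    rw [Fintype.sum_prod_type]
    refine Finset.sum_congr rfl fun h _ => ?_
    have e : ∀ c, (L₁ *ᵥ v₀ - u) (x, (h, c)) = if c = c₀ then
        (Φ *ᵥ (fun p => ψ p.1 * if p.2 = h₀ then 1 else 0) - fun p : Ω × H => ψ p.1 * a p.2) (x, h)
          else 0 := by
      intro c
      rw [Pi.sub_apply, lift_mulVec]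
      simp only [Equiv.refl_apply, Equiv.refl_symm, hv₀, hu, Prod.mk.injEq, Pi.sub_apply]
      by_cases hc : c = c₀
      · simp [hc]
      · simp only [hc, and_false, if_false, mul_zero, sub_zero]
        exact congrFun (Matrix.mulVec_zero Φ) (x, h)
    simp only [e]
    rw [Finset.sum_eq_single c₀]
    · simp
    · intro c _ hc
      simp [hc]
    · simp
  have e₂ : l2 (L₂ *ᵥ u - u') ≤ δ₂ := by
    refine l2_le_of_sq_le hδ₂ ?_
    have e : ∀ x h c, (L₂ *ᵥ u - u') (x, (h, c)) =
        a h * (Θ h *ᵥ (fun p => ψ p.1 * if p.2 = c₀ then 1 else 0) -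
          fun p : Ω × C => ψ p.1 * b h p.2) (x, c) := by
      intro x h c
      have e' : (fun q : Ω × C => ψ q.1 * a h * if q.2 = c₀ then 1 else 0)
          = a h • fun p => ψ p.1 * if p.2 = c₀ then 1 else 0 := by
        ext q
        simp only [Pi.smul_apply, smul_eq_mul]
        ring
      rw [Pi.sub_apply, lift_mulVec]
      simp only [Equiv.prodComm_apply, Equiv.prodComm_symm, Prod.swap_prod_mk, hu, hu',
        Pi.sub_apply]
      rw [e', Matrix.mulVec_smul]
      simp only [Pi.smul_apply, smul_eq_mul]
      ring
    have e2 : ∑ p, ‖(L₂ *ᵥ u - u') p‖ ^ 2 = ∑ h, ‖a h‖ ^ 2 *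
        l2 (Θ h *ᵥ (fun p => ψ p.1 * if p.2 = c₀ then 1 else 0) -
          fun p : Ω × C => ψ p.1 * b h p.2) ^ 2 := by
      rw [Fintype.sum_prod_type]
      simp only [Fintype.sum_prod_type, e, l2_sq, norm_mul, mul_pow, Finset.mul_sum]
      rw [Finset.sum_comm]
    rw [e2]
    calc _ ≤ ∑ h, ‖a h‖ ^ 2 * δ₂ ^ 2 := by
          refine Finset.sum_le_sum fun h _ => ?_
          by_cases hh : a h = 0
          · simp [hh]
          · exact mul_le_mul_of_nonneg_left
              (pow_le_pow_left₀ (l2_nonneg _) (h₂ h hh) 2) (sq_nonneg _)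
      _ ≤ δ₂ ^ 2 := by
          rw [← Finset.sum_mul]
          exact mul_le_of_le_one_left (sq_nonneg _) ha
  have hfin : (L₂ * L₁) *ᵥ v₀ - u' = L₂ *ᵥ (L₁ *ᵥ v₀ - u) + (L₂ *ᵥ u - u') := by
    rw [Matrix.mulVec_sub, Matrix.mulVec_mulVec]
    abel
  rw [hfin]
  refine (l2_add_le _ _).trans ?_
  rw [l2_mulVec hL₂u]
  linarith

/-- Iterating the decision step: starting from an upper bound `w` on the mean, `N` rounds give a
lower bound `g` on the mean with error at most `w (15 / 16) ^ N`, and almost leave the register in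
`|ψ_D⟩`. The amplitudes `a` of the records are subnormalized: they vanish on the records with a
wrong bound, whose weight is part of the error. The record register `H` does not depend on `f`, `w`
and the scale `α`, so that these may be controlled by other registers. -/
lemma exists_bisection (m N : ℕ) (k : ℕ → ℕ) :
    ∃ (H : Type) (_ : Fintype H) (_ : DecidableEq H) (h₀ : H), ∀ (f : Ω → ℝ) (α w : ℝ),
      ∃ (Φ : (Ω → ℝ) → Matrix (Ω × H) (Ω × H) ℂ) (g : H → ℝ),
        Implements (∑ j ∈ Finset.range N, m * k j) Φ ∧
        ∀ D ∈ stdSimplex ℝ Ω, ∀ s, s ≤ 1 / 10 → (∀ x, 0 ≤ f x) → 0 < α → 0 ≤ mean D f →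
          mean D f ≤ w → α * mean D f ≤ s → α ^ 2 * secondMoment D f ≤ s ^ 2 →
          (∀ j < N, Real.pi / 2 ≤ k j * (α * (w * (15 / 16) ^ j)) ∧
            k j * (α * (w * (15 / 16) ^ j)) ≤ Real.pi / 2 + 1 / 10) →
          ∃ a : H → ℂ, ∑ h, ‖a h‖ ^ 2 ≤ 1 ∧
            (∀ h, a h ≠ 0 → 0 ≤ g h ∧ g h ≤ mean D f ∧ mean D f ≤ g h + w * (15 / 16) ^ N) ∧
            l2 (Φ D *ᵥ (fun p => coherent D p.1 * if p.2 = h₀ then 1 else 0) -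
              fun p => coherent D p.1 * a p.2) ≤ N * (6 * s + √((1 / 2) ^ m)) := by
  induction N with
  | zero =>
    refine ⟨Unit, inferInstance, inferInstance, (), fun f α w => ⟨fun _ => 1, fun _ => 0,
      Implements.of_unitary (one_mem _), fun D hD s _ _ _ hμ0 hμ _ _ _ => ⟨fun _ => 1, ?_, ?_, ?_⟩⟩⟩
    · simp
    · intro _ _
      simpa using ⟨hμ0, hμ⟩
    · simp [l2]
  | succ N ih =>
    obtain ⟨H, _, _, h₀, ih⟩ := ih
    refine ⟨H × (Fin m → Bool), inferInstance, inferInstance, (h₀, fun _ => false),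
      fun f α w => ?_⟩
    obtain ⟨Φ, g, hΦ, ih⟩ := ih f α w
    choose Θ hΘ hdec using fun h => exists_decision f α (g h) (w * (15 / 16) ^ N) m (k N)
    have hI : Implements (∑ j ∈ Finset.range (N + 1), m * k j) fun D =>
        lift (Equiv.prodComm H (Fin m → Bool)) (fun h => Θ h D) *
          lift (Equiv.refl (H × (Fin m → Bool))) (fun _ => Φ D) := by
      rw [Finset.sum_range_succ]
      exact (Implements.lift (Equiv.prodComm H (Fin m → Bool)) hΘ).mul
        (Implements.lift (Equiv.refl (H × (Fin m → Bool))) fun _ => hΦ)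
    -- a vote `true` rules out `μ < g + w / 16`, a vote `false` rules out `g + 15 w / 16 < μ`
    refine ⟨_, fun p => if majority p.2 then g p.1 + w * (15 / 16) ^ N / 16 else g p.1, hI, ?_⟩
    intro D hD s hs hf hα hμ0 hμw hαμ hαφ hk
    obtain ⟨a, ha1, hag, haΦ⟩ := ih D hD s hs hf hα hμ0 hμw hαμ hαφ fun j hj => hk j (by omega)
    have hex : ∀ h, ∃ b : (Fin m → Bool) → ℂ, a h ≠ 0 → ∑ c, ‖b c‖ ^ 2 = 1 ∧
        ∑ c, (if (majority c ∧ mean D f < g h + w * (15 / 16) ^ N / 16) ∨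
          (¬ majority c ∧ g h + 15 * (w * (15 / 16) ^ N) / 16 < mean D f) then ‖b c‖ ^ 2 else 0) ≤
            (1 / 2) ^ m ∧
        l2 (Θ h D *ᵥ (fun p => coherent D p.1 * if p.2 = (fun _ => false) then 1 else 0) -
          fun p => coherent D p.1 * b p.2) ≤ 6 * s := by
      intro h
      by_cases hh : a h = 0
      · exact ⟨0, fun h' => absurd hh h'⟩
      · obtain ⟨hg0, hgμ, hμg⟩ := hag h hh
        obtain ⟨b, hb⟩ := hdec h D hD s hs hf hα hg0 hgμ hμg hαμ hαφ (hk N (by omega)).1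
          (hk N (by omega)).2
        exact ⟨b, fun _ => hb⟩
    choose b hb using hex
    set bad : H × (Fin m → Bool) → Prop := fun p =>
      (majority p.2 ∧ mean D f < g p.1 + w * (15 / 16) ^ N / 16) ∨
        (¬ majority p.2 ∧ g p.1 + 15 * (w * (15 / 16) ^ N) / 16 < mean D f) with hbad
    classical
    have hbsum : ∀ h, ‖a h‖ ^ 2 * ∑ c, ‖b h c‖ ^ 2 = ‖a h‖ ^ 2 := by
      intro h
      by_cases hh : a h = 0
      · simp [hh]
      · rw [(hb h hh).1, mul_one]
    -- records with a wrong decision are cut off, at the price of `√((1 / 2) ^ m)` in the error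
    refine ⟨fun p => if bad p then 0 else a p.1 * b p.1 p.2, ?_, ?_, ?_⟩
    · refine le_trans (Finset.sum_le_sum (g := fun p => ‖a p.1‖ ^ 2 * ‖b p.1 p.2‖ ^ 2)
        fun p _ => ?_) ?_
      · beta_reduce
        split_ifs
        · rw [norm_zero, zero_pow two_ne_zero]; positivity
        · rw [norm_mul, mul_pow]
      · rw [Fintype.sum_prod_type]
        simp only [← Finset.mul_sum, hbsum]
        exact ha1
    · rintro ⟨h, c⟩ hne
      have hnb : ¬ bad (h, c) := fun hb => hne (by simp [hb])
      have hah : a h ≠ 0 := fun h0 => hne (by simp [h0])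
      obtain ⟨hg0, hgμ, hμg⟩ := hag h hah
      have hw : 0 ≤ w * (15 / 16) ^ N := by linarith
      simp only [hbad, not_or, not_and, not_lt] at hnb
      rw [pow_succ]
      by_cases hc : majority c
      · have := hnb.1 hc
        simp only [hc, if_true]
        exact ⟨by linarith, by linarith, by linarith⟩
      · have := hnb.2 hc
        simp only [hc, if_false]
        exact ⟨by linarith, by linarith, by linarith⟩
    · have hs0 : 0 ≤ s := (mul_nonneg hα.le hμ0).trans hαμ
      have h1 := l2_lift_mul_lift_sub_le (fun h => (hΘ h).mem_unitaryGroup hD) ha1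
        (mul_nonneg (by norm_num) hs0 : 0 ≤ 6 * s) haΦ fun h hh => (hb h hh).2.2
      have h2 : l2 ((fun p : Ω × (H × (Fin m → Bool)) =>
          coherent D p.1 * (a p.2.1 * b p.2.1 p.2.2)) -
            fun p => coherent D p.1 * if bad p.2 then 0 else a p.2.1 * b p.2.1 p.2.2) ≤
              √((1 / 2) ^ m) := by
        set a' : H × (Fin m → Bool) → ℂ := fun z => if bad z then a z.1 * b z.1 z.2 else 0 with ha'
        have e : ((fun p : Ω × (H × (Fin m → Bool)) =>
          coherent D p.1 * (a p.2.1 * b p.2.1 p.2.2)) -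
            fun p => coherent D p.1 * if bad p.2 then 0 else a p.2.1 * b p.2.1 p.2.2) =
            fun p => coherent D p.1 * a' p.2 := by
          ext p
          rw [ha']
          simp only [Pi.sub_apply]
          split_ifs <;> ring
        rw [e]
        refine Real.le_sqrt_of_sq_le ?_
        rw [l2_coherent_mul hD, Fintype.sum_prod_type]
        calc _ ≤ ∑ h, ‖a h‖ ^ 2 * (1 / 2) ^ m := by
              refine Finset.sum_le_sum fun h _ => ?_
              by_cases hh : a h = 0
              · simp [ha', hh]
              · refine le_trans (le_of_eq ?_)
                  (mul_le_mul_of_nonneg_left (hb h hh).2.1 (sq_nonneg _))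
                rw [Finset.mul_sum]
                refine Finset.sum_congr rfl fun c _ => ?_
                rw [ha']
                by_cases hc : bad (h, c)
                · beta_reduce
                  rw [if_pos hc, if_pos hc, norm_mul, mul_pow]
                · beta_reduce
                  rw [if_neg hc, if_neg hc]
                  simp
          _ ≤ (1 / 2) ^ m := by
              rw [← Finset.sum_mul]
              exact mul_le_of_le_one_left (by positivity) ha1
      have h3 := (l2_add_le _ _).trans (add_le_add h1 h2)
      rw [sub_add_sub_cancel] at h3
      refine h3.trans (le_of_eq ?_)
      push_cast
      ring

end Bisection

section Sampling

variable {Ω : Type*} [Fintype Ω] [DecidableEq Ω]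

/-! ### The scale of the mean from classical samples -/

lemma sum_prod_pi {n : ℕ} (F : Fin n → Ω → ℝ) :
    ∑ q : Fin n → Ω, ∏ i, F i (q i) = ∏ i, ∑ x, F i x := by
  rw [Finset.prod_univ_sum, Fintype.piFinset_univ]

/-- The empirical mean of `f` on the sample `q` (with value `0` for an empty sample). -/
noncomputable def sampleMean {n : ℕ} (f : Ω → ℝ) (q : Fin n → Ω) : ℝ := (∑ i, f (q i)) / n

lemma exp_neg_le_quadratic {x : ℝ} (hx : 0 ≤ x) : Real.exp (-x) ≤ 1 - x + x ^ 2 / 2 := by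
  have h := Real.quadratic_le_exp_of_nonneg hx
  have h0 : 0 < 1 + x + x ^ 2 / 2 := by positivity
  rw [Real.exp_neg]
  refine (inv_anti₀ h0 h).trans ?_
  rw [inv_eq_one_div, div_le_iff₀ h0]
  nlinarith [sq_nonneg (x ^ 2)]

/-- The lower tail of the empirical mean of a nonnegative function is exponentially small, although
only its second moment is bounded. -/
lemma sum_sampleMean_lt_le {D f : Ω → ℝ} (hD : D ∈ stdSimplex ℝ Ω) (hf : ∀ x, 0 ≤ f x) {B : ℝ}
    (hB : 0 < B) (hμ : 0 < mean D f) (hφ : secondMoment D f ≤ B * mean D f ^ 2) {n : ℕ}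
    (hn : 9 * B ≤ n) :
    ∑ q : Fin n → Ω, (if 8 * sampleMean f q < mean D f then ∏ i, D (q i) else 0) ≤ 1 / 20 := by
  set μ := mean D f with hμd
  have hn0 : (0 : ℝ) < n := by linarith
  -- the exponent that minimizes the moment generating function bound
  set lam := 7 / 8 / (B * μ) with hlam
  have hlam0 : 0 < lam := by positivity
  have hlamμ : lam * μ = 7 / 8 / B := by rw [hlam]; field_simp
  have hlamφ : lam ^ 2 * secondMoment D f ≤ 49 / 64 / B := by
    have : lam ^ 2 * (B * μ ^ 2) = 49 / 64 / B := by rw [hlam]; field_simp; norm_num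
    rw [← this]
    exact mul_le_mul_of_nonneg_left hφ (sq_nonneg _)
  have hmgf : ∑ x, D x * Real.exp (-(lam * f x)) ≤ Real.exp (-(63 / 128 / B)) := by
    calc ∑ x, D x * Real.exp (-(lam * f x))
        ≤ ∑ x, D x * (1 - lam * f x + (lam * f x) ^ 2 / 2) :=
          Finset.sum_le_sum fun x _ => mul_le_mul_of_nonneg_left
            (exp_neg_le_quadratic (mul_nonneg hlam0.le (hf x))) (hD.1 x)
      _ = 1 - lam * μ + lam ^ 2 * secondMoment D f / 2 := by
          have : ∀ x, D x * (1 - lam * f x + (lam * f x) ^ 2 / 2) =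
            D x - lam * (D x * f x) + lam ^ 2 / 2 * (D x * f x ^ 2) := fun x => by ring
          simp only [this, Finset.sum_add_distrib, Finset.sum_sub_distrib, ← Finset.mul_sum, hD.2]
          rw [hμd, mean, secondMoment]
          ring
      _ ≤ -(63 / 128 / B) + 1 := by
          rw [hlamμ]
          have e : -(63 / 128 / B) = -(7 / 8 / B) + (49 / 64 / B) / 2 := by ring
          linarith
      _ ≤ _ := Real.add_one_le_exp _
  have hpt : ∀ q : Fin n → Ω, (if 8 * sampleMean f q < μ then ∏ i, D (q i) else 0) ≤
      Real.exp (n * (7 / 64 / B)) * ∏ i, (D (q i) * Real.exp (-(lam * f (q i)))) := by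
    intro q
    have hnn : 0 ≤ ∏ i, D (q i) := Finset.prod_nonneg fun i _ => hD.1 _
    rw [Finset.prod_mul_distrib, ← Real.exp_sum, Finset.sum_neg_distrib, ← Finset.mul_sum]
    split_ifs with h
    · have h1 : 8 * (∑ i, f (q i)) < n * μ := by
        rw [sampleMean, ← mul_div_assoc, div_lt_iff₀ hn0] at h
        linarith
      have h2 : 1 ≤ Real.exp (n * (7 / 64 / B)) * Real.exp (-(lam * ∑ i, f (q i))) := by
        rw [← Real.exp_add]
        refine Real.one_le_exp ?_
        have h3 := mul_lt_mul_of_pos_left h1 hlam0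
        have h4 : lam * (n * μ) = n * (7 / 8 / B) := by rw [← hlamμ]; ring
        have h5 : (n : ℝ) * (7 / 64 / B) = n * (7 / 8 / B) / 8 := by ring
        linarith
      nlinarith
    · positivity
  refine (Finset.sum_le_sum fun q _ => hpt q).trans ?_
  rw [← Finset.mul_sum, sum_prod_pi fun _ x => D x * Real.exp (-(lam * f x)), Finset.prod_const,
    Finset.card_univ, Fintype.card_fin]
  have h1 : 0 ≤ ∑ x, D x * Real.exp (-(lam * f x)) :=
    Finset.sum_nonneg fun x _ => mul_nonneg (hD.1 x) (Real.exp_pos _).le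
  calc _ ≤ Real.exp (n * (7 / 64 / B)) * Real.exp (-(63 / 128 / B)) ^ n :=
        mul_le_mul_of_nonneg_left (pow_le_pow_left₀ h1 hmgf n) (Real.exp_pos _).le
    _ = Real.exp (-(49 / 128 * (n / B))) := by
        rw [← Real.exp_nat_mul, ← Real.exp_add]
        congr 1
        ring
    _ ≤ Real.exp (-3) := by
        have : 9 ≤ n / B := by rwa [le_div_iff₀ hB]
        exact Real.exp_le_exp.2 (by linarith)
    _ ≤ 1 / 20 := by
        have h2 := Real.exp_one_gt_d9
        have h3 : Real.exp 3 = Real.exp 1 ^ 3 := by rw [← Real.exp_nat_mul]; norm_num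
        have h4 : (2.7182818283 : ℝ) ^ 3 ≤ Real.exp 1 ^ 3 :=
          pow_le_pow_left₀ (by norm_num) h2.le 3
        rw [Real.exp_neg, h3, inv_eq_one_div]
        exact one_div_le_one_div_of_le (by norm_num) (le_trans (by norm_num) h4)

/-- Markov's inequality for the empirical mean. -/
lemma sum_lt_sampleMean_le {D f : Ω → ℝ} (hD : D ∈ stdSimplex ℝ Ω) (hf : ∀ x, 0 ≤ f x)
    (hμ : 0 < mean D f) {n : ℕ} (hn : 0 < n) :
    ∑ q : Fin n → Ω, (if 128 * mean D f < sampleMean f q then ∏ i, D (q i) else 0) ≤ 1 / 128 := by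
  set μ := mean D f with hμd
  have hn0 : (0 : ℝ) < n := by exact_mod_cast hn
  have hmean : ∀ j : Fin n, ∑ q : Fin n → Ω, (∏ i, D (q i)) * f (q j) = μ := by
    intro j
    have e : ∀ q : Fin n → Ω, (∏ i, D (q i)) * f (q j) =
        ∏ i, (D (q i) * if i = j then f (q i) else 1) := by
      intro q
      rw [Finset.prod_mul_distrib, Finset.prod_ite_eq']
      simp
    rw [Finset.sum_congr rfl fun q _ => e q,
      sum_prod_pi fun i x => D x * if i = j then f x else 1, Finset.prod_eq_single j]
    · simp [hμd, mean]
    · intro i _ hi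
      simpa [hi] using hD.2
    · simp
  have hpt : ∀ q : Fin n → Ω, (if 128 * μ < sampleMean f q then ∏ i, D (q i) else 0) ≤
      1 / (128 * μ * n) * ∑ j, (∏ i, D (q i)) * f (q j) := by
    intro q
    have hnn : 0 ≤ ∏ i, D (q i) := Finset.prod_nonneg fun i _ => hD.1 _
    have hs : 0 ≤ ∑ j, f (q j) := Finset.sum_nonneg fun j _ => hf _
    rw [← Finset.mul_sum, one_div, inv_mul_eq_div]
    split_ifs with h
    · rw [sampleMean, lt_div_iff₀ hn0] at h
      rw [le_div_iff₀ (by positivity)]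
      exact mul_le_mul_of_nonneg_left h.le hnn
    · positivity
  refine (Finset.sum_le_sum fun q _ => hpt q).trans (le_of_eq ?_)
  rw [← Finset.mul_sum, Finset.sum_comm]
  simp only [hmean, Finset.sum_const, Finset.card_univ, Fintype.card_fin, nsmul_eq_mul]
  field_simp

end Sampling

section Run

variable {Ω : Type*} [Fintype Ω] [DecidableEq Ω]

/-! ### One run: samples fix the scale, bisection finds the mean -/

lemma coherent_norm_sq {D : Ω → ℝ} (hD : D ∈ stdSimplex ℝ Ω) (x : Ω) :
    ‖coherent D x‖ ^ 2 = D x := by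
  simp [coherent, Real.sq_sqrt (hD.1 x)]

lemma l2_coherent_init {H : Type*} [Fintype H] [DecidableEq H] {D : Ω → ℝ}
    (hD : D ∈ stdSimplex ℝ Ω) (h₀ : H) :
    l2 (fun p : Ω × H => coherent D p.1 * if p.2 = h₀ then 1 else 0) = 1 := by
  rw [← sq_eq_sq₀ (l2_nonneg _) zero_le_one, l2_coherent_mul hD (fun h => if h = h₀ then 1 else 0),
    Finset.sum_eq_single h₀]
  · simp
  · intro h _ hh
    simp [hh]
  · simp

open Classical in
/-- A single run: `n` classical samples determine the scale on which a bisection with `N` rounds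
then finds the mean, with one further copy of `|ψ_D⟩`. It fails with probability at most `1/16`. -/
lemma exists_run (f : Ω → ℝ) {B ε s : ℝ} {n m N : ℕ} {k : ℕ → ℕ} (hf : ∀ x, 0 ≤ f x) (hB : 1 ≤ B)
    (hn : 9 * B ≤ n) (hs0 : 0 < s) (hs : s ≤ 1 / 10)
    (hk : ∀ j < N, Real.pi / 2 ≤ k j * (s / √B * (15 / 16) ^ j) ∧
      k j * (s / √B * (15 / 16) ^ j) ≤ Real.pi / 2 + 1 / 10)
    (hN : 1024 * (15 / 16) ^ N ≤ ε) (herr : N * (6 * s + √((1 / 2) ^ m)) ≤ 1 / 16) :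
    ∃ (H : Type) (_ : Fintype H) (_ : DecidableEq H) (h₀ : H)
      (Φ : (Fin n → Ω) → (Ω → ℝ) → Matrix (Ω × H) (Ω × H) ℂ) (est : (Fin n → Ω) → H → ℝ),
      (∀ q, Implements (∑ j ∈ Finset.range N, m * k j) (Φ q)) ∧
      ∀ D ∈ stdSimplex ℝ Ω, BoundedRelativeVariance D f B →
        ∑ q : Fin n → Ω, (∏ i, D (q i)) * ∑ p : Ω × H,
          (if IsRelativeEstimate ε (mean D f) (est q p.2) then 0 else
            ‖(Φ q D *ᵥ fun p => coherent D p.1 * if p.2 = h₀ then 1 else 0) p‖ ^ 2) ≤ 1 / 16 := by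
  obtain ⟨H, _, _, h₀, hH⟩ := exists_bisection (Ω := Ω) m N k
  choose Φ g hΦ hg using hH f
  -- the upper bound on the mean is `8` times the sample mean, and the scale `α` is its inverse up
  -- to the factor `s / √B`, which makes the second moment of `α f` at most `s²`
  refine ⟨H, inferInstance, inferInstance, h₀,
    fun q => Φ (s / (√B * (8 * sampleMean f q))) (8 * sampleMean f q),
    fun q => g (s / (√B * (8 * sampleMean f q))) (8 * sampleMean f q), fun q => hΦ _ _,
    fun D hD hBV => ?_⟩
  obtain ⟨hμ, hφ⟩ := hBV
  set μ := mean D f with hμd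
  have hB0 : 0 < B := by linarith
  have hsB : 0 < √B := Real.sqrt_pos.2 hB0
  have hsB1 : 1 ≤ √B := Real.one_le_sqrt.2 hB
  have hsq : √B ^ 2 = B := Real.sq_sqrt hB0.le
  have hφ' : secondMoment D f ≤ B * μ ^ 2 := by rwa [div_le_iff₀ (by positivity)] at hφ
  have hD0 : ∀ q : Fin n → Ω, 0 ≤ ∏ i, D (q i) := fun q => Finset.prod_nonneg fun i _ => hD.1 _
  have htail := add_le_add (sum_sampleMean_lt_le hD hf hB0 hμ hφ' hn)
    (sum_lt_sampleMean_le hD hf hμ (n := n) (by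
      have : (0 : ℝ) < n := by linarith
      exact_mod_cast this))
  have hD1 : ∑ q : Fin n → Ω, ∏ i, D (q i) = 1 := by
    rw [sum_prod_pi fun _ x => D x]
    simp [hD.2]
  set bad : (Fin n → Ω) → ℝ := fun q => ∑ p : Ω × H,
    (if IsRelativeEstimate ε μ (g (s / (√B * (8 * sampleMean f q))) (8 * sampleMean f q) p.2) then 0
      else ‖(Φ (s / (√B * (8 * sampleMean f q))) (8 * sampleMean f q) D *ᵥ
        fun p => coherent D p.1 * if p.2 = h₀ then 1 else 0) p‖ ^ 2) with hbad
  have hbad1 : ∀ q, bad q ≤ 1 := by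
    intro q
    calc bad q ≤ ∑ p : Ω × H, ‖(Φ (s / (√B * (8 * sampleMean f q))) (8 * sampleMean f q) D *ᵥ
          fun p => coherent D p.1 * if p.2 = h₀ then 1 else 0) p‖ ^ 2 := by
          refine Finset.sum_le_sum fun p _ => ?_
          split_ifs
          · positivity
          · exact le_rfl
      _ = 1 := by
          rw [← l2_sq, l2_mulVec ((hΦ _ _).mem_unitaryGroup hD), l2_coherent_init hD, one_pow]
  have hgood : ∀ q, ¬ 8 * sampleMean f q < μ → ¬ 128 * μ < sampleMean f q → bad q ≤ 1 / 256 := by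
    intro q h1 h2
    rw [not_lt] at h1 h2
    set M := sampleMean f q with hM
    have hM0 : 0 < M := by linarith
    set α := s / (√B * (8 * M)) with hα
    have hα0 : 0 < α := by positivity
    have hαM : α * (8 * M) = s / √B := by rw [hα]; field_simp
    have hsle : s / √B ≤ s := div_le_self hs0.le hsB1
    have hαμ : α * μ ≤ s / √B := by
      rw [← hαM]
      exact mul_le_mul_of_nonneg_left h1 hα0.le
    have hαφ : α ^ 2 * secondMoment D f ≤ s ^ 2 := by
      calc α ^ 2 * secondMoment D f ≤ α ^ 2 * (B * μ ^ 2) :=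
            mul_le_mul_of_nonneg_left hφ' (sq_nonneg _)
        _ = (α * μ) ^ 2 * B := by ring
        _ ≤ (s / √B) ^ 2 * B := mul_le_mul_of_nonneg_right
            (pow_le_pow_left₀ (by positivity) hαμ 2) hB0.le
        _ = s ^ 2 := by rw [div_pow, hsq]; field_simp
    obtain ⟨a, -, hag, haΦ⟩ := hg α (8 * M) D hD s hs hf hα0 hμ.le h1 (hαμ.trans hsle) hαφ
      fun j hj => by
        rw [← mul_assoc α, hαM]
        exact hk j hj
    have hw : 8 * M * (15 / 16) ^ N ≤ ε * μ := by
      calc 8 * M * (15 / 16) ^ N ≤ 8 * (128 * μ) * (15 / 16) ^ N := by gcongr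
        _ = 1024 * (15 / 16) ^ N * μ := by ring
        _ ≤ ε * μ := mul_le_mul_of_nonneg_right hN hμ.le
    set v := Φ α (8 * M) D *ᵥ fun p => coherent D p.1 * if p.2 = h₀ then 1 else 0 with hv
    have hle : bad q ≤ l2 (v - fun p => coherent D p.1 * a p.2) ^ 2 := by
      rw [l2_sq]
      refine Finset.sum_le_sum fun p _ => ?_
      split_ifs with hgd
      · positivity
      · have h0 : a p.2 = 0 := by
          by_contra hne
          obtain ⟨-, h3, h4⟩ := hag p.2 hne
          refine hgd ?_
          rw [IsRelativeEstimate, abs_le]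
          constructor <;> nlinarith
        rw [Pi.sub_apply, h0, mul_zero, sub_zero]
    calc bad q ≤ (1 / 16) ^ 2 :=
          hle.trans (pow_le_pow_left₀ (l2_nonneg _) (haΦ.trans herr) 2)
      _ = 1 / 256 := by norm_num
  have hpt : ∀ q, (∏ i, D (q i)) * bad q ≤ (if 8 * sampleMean f q < μ then ∏ i, D (q i) else 0) +
      (if 128 * μ < sampleMean f q then ∏ i, D (q i) else 0) + (∏ i, D (q i)) * (1 / 256) := by
    intro q
    have h1 := mul_le_mul_of_nonneg_left (hbad1 q) (hD0 q)
    have h0 := hD0 q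
    by_cases hA : 8 * sampleMean f q < μ
    · rw [if_pos hA]
      split_ifs <;> linarith
    · by_cases hC : 128 * μ < sampleMean f q
      · rw [if_pos hC, if_neg hA]
        linarith
      · rw [if_neg hA, if_neg hC]
        linarith [mul_le_mul_of_nonneg_left (hgood q hA hC) h0]
  refine (Finset.sum_le_sum fun q _ => hpt q).trans ?_
  rw [Finset.sum_add_distrib, Finset.sum_add_distrib, ← Finset.sum_mul, hD1]
  linarith

end Run

section Amplification

variable {Ω : Type*} [Fintype Ω] [DecidableEq Ω]

/-! ### Independent runs and their median -/

lemma one_submatrix_mem_unitaryGroup {ι : Type*} [Fintype ι] [DecidableEq ι] (σ : ι ≃ ι) :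
    (1 : Matrix ι ι ℂ).submatrix σ id ∈ Matrix.unitaryGroup ι ℂ := by
  rw [Matrix.mem_unitaryGroup_iff, Matrix.star_eq_conjTranspose, Matrix.conjTranspose_submatrix,
    Matrix.conjTranspose_one]
  have := Matrix.submatrix_mul_equiv (1 : Matrix ι ι ℂ) (1 : Matrix ι ι ℂ) σ (Equiv.refl ι) σ
  rw [Equiv.coe_refl, one_mul, Matrix.submatrix_one_equiv] at this
  exact this

lemma one_submatrix_mulVec {ι : Type*} [Fintype ι] [DecidableEq ι] (σ : ι ≃ ι) (v : ι → ℂ)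
    (i : ι) : ((1 : Matrix ι ι ℂ).submatrix σ id *ᵥ v) i = v (σ i) := by
  simp [Matrix.mulVec, dotProduct, Matrix.one_apply]

/-- The exchange of the working register with the first register of a block of registers. -/
def swapHead (Ω : Type*) {Z H : Type*} {n : ℕ} :
    Ω × (Z × ((Fin (n + 1) → Ω) × H)) ≃ Ω × (Z × ((Fin (n + 1) → Ω) × H)) where
  toFun p := (p.2.2.1 0, (p.2.1, (Fin.cons p.1 (Fin.tail p.2.2.1), p.2.2.2)))
  invFun p := (p.2.2.1 0, (p.2.1, (Fin.cons p.1 (Fin.tail p.2.2.1), p.2.2.2)))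
  left_inv p := by simp
  right_inv p := by simp

/-- The amplitudes of the registers used up by one run: the `n` samples, the register that the
program `Φ` has worked on, and its record. -/
noncomputable def runAmplitude {n : ℕ} {H : Type*} [Fintype H] [DecidableEq H] (h₀ : H)
    (Φ : (Fin n → Ω) → (Ω → ℝ) → Matrix (Ω × H) (Ω × H) ℂ) (D : Ω → ℝ)
    (b : (Fin (n + 1) → Ω) × H) : ℂ :=
  (∏ i : Fin n, coherent D (b.1 i.succ)) *
    (Φ (Fin.tail b.1) D *ᵥ fun p => coherent D p.1 * if p.2 = h₀ then 1 else 0) (b.1 0, b.2)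

/-- One more run, on fresh copies. The run works on the current copy of `|ψ_D⟩`, which is then
exchanged with the fresh one, so that the working register is exactly in the state `|ψ_D⟩` again and
the runs are independent. -/
lemma exists_append_run {Z Z' H : Type*} [Fintype Z] [DecidableEq Z] [Fintype Z'] [DecidableEq Z']
    [Fintype H] [DecidableEq H] {n S T : ℕ} (E : Z' ≃ Z × ((Fin (n + 1) → Ω) × H)) {h₀ : H}
    {Φ : (Fin n → Ω) → (Ω → ℝ) → Matrix (Ω × H) (Ω × H) ℂ} (hΦ : ∀ q, Implements T (Φ q))
    {Ψ : (Ω → ℝ) → Matrix (Ω × Z) (Ω × Z) ℂ} (hΨ : Implements S Ψ)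
    {init : (Ω → ℝ) → Z → ℂ} {init' : (Ω → ℝ) → Z' → ℂ}
    (hinit : ∀ D z b, init' D (E.symm (z, b)) =
      init D z * ((∏ i, coherent D (b.1 i)) * if b.2 = h₀ then 1 else 0))
    {G : (Ω → ℝ) → Z → ℂ}
    (hG : ∀ D, Ψ D *ᵥ (fun p => coherent D p.1 * init D p.2) = fun p => coherent D p.1 * G D p.2) :
    ∃ Ψ' : (Ω → ℝ) → Matrix (Ω × Z') (Ω × Z') ℂ, Implements (S + T) Ψ' ∧
      ∀ D, Ψ' D *ᵥ (fun p => coherent D p.1 * init' D p.2) =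
        fun p => coherent D p.1 * (G D (E p.2).1 * runAmplitude h₀ Φ D (E p.2).2) := by
  -- the record of the run is the target register, everything else controls the run
  set E₂ : Z' ≃ H × (Z × (Fin (n + 1) → Ω)) :=
    E.trans ((Equiv.prodAssoc Z (Fin (n + 1) → Ω) H).symm.trans (Equiv.prodComm _ _)) with hE₂
  set σ : Ω × Z' ≃ Ω × Z' := ((Equiv.refl Ω).prodCongr E).trans
    ((swapHead Ω).trans ((Equiv.refl Ω).prodCongr E).symm) with hσ
  have hI := ((Implements.of_unitary (one_submatrix_mem_unitaryGroup σ)).mul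
    ((Implements.lift E₂ (Φ := fun c => Φ (Fin.tail c.2)) fun c => hΦ _).mul
      (Implements.lift E (Φ := fun _ => Ψ) fun _ => hΨ)))
  rw [add_zero] at hI
  refine ⟨_, hI, fun D => ?_⟩
  rw [← Matrix.mulVec_mulVec, ← Matrix.mulVec_mulVec]
  have h1 : lift E (fun _ => Ψ D) *ᵥ (fun p => coherent D p.1 * init' D p.2) = fun p =>
      coherent D p.1 * (G D (E p.2).1 *
        ((∏ i, coherent D ((E p.2).2.1 i)) * if (E p.2).2.2 = h₀ then 1 else 0)) := by
    ext p
    rw [lift_mulVec]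
    have e : (fun q : Ω × Z => coherent D q.1 * init' D (E.symm (q.2, (E p.2).2))) =
        ((∏ i, coherent D ((E p.2).2.1 i)) * if (E p.2).2.2 = h₀ then 1 else 0) •
          fun q => coherent D q.1 * init D q.2 := by
      ext q
      rw [hinit, Pi.smul_apply, smul_eq_mul]
      ring
    simp only [e]
    rw [Matrix.mulVec_smul, hG, Pi.smul_apply, smul_eq_mul]
    ring
  rw [h1]
  ext p
  rw [one_submatrix_mulVec, lift_mulVec]
  have e : ∀ c : Z × (Fin (n + 1) → Ω), (fun q : Ω × H => (fun p : Ω × Z' =>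
      coherent D p.1 * (G D (E p.2).1 * ((∏ i, coherent D ((E p.2).2.1 i)) *
        if (E p.2).2.2 = h₀ then 1 else 0))) (q.1, E₂.symm (q.2, c))) =
      (G D c.1 * ∏ i, coherent D (c.2 i)) •
        fun q => coherent D q.1 * if q.2 = h₀ then 1 else 0 := by
    intro c
    ext q
    simp [hE₂]
    ring_nf
  rw [e, Matrix.mulVec_smul, Pi.smul_apply, smul_eq_mul]
  simp [hσ, hE₂, swapHead, runAmplitude, Fin.prod_univ_succ, Fin.tail]
  ring

/-- The weight of a block of registers used up by a run is an average over the samples. -/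
lemma sum_runAmplitude {n : ℕ} {H : Type*} [Fintype H] [DecidableEq H] (h₀ : H)
    (Φ : (Fin n → Ω) → (Ω → ℝ) → Matrix (Ω × H) (Ω × H) ℂ) {D : Ω → ℝ} (hD : D ∈ stdSimplex ℝ Ω)
    (u : (Fin n → Ω) → H → ℝ) :
    ∑ b, ‖runAmplitude h₀ Φ D b‖ ^ 2 * u (Fin.tail b.1) b.2 =
      ∑ q : Fin n → Ω, (∏ i, D (q i)) * ∑ p : Ω × H,
        ‖(Φ q D *ᵥ fun p => coherent D p.1 * if p.2 = h₀ then 1 else 0) p‖ ^ 2 * u q p.2 := by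
  rw [Fintype.sum_prod_type, ← (Fin.consEquiv fun _ => Ω).sum_comp, Fintype.sum_prod_type_right]
  refine Finset.sum_congr rfl fun q _ => ?_
  rw [Fintype.sum_prod_type, Finset.mul_sum]
  refine Finset.sum_congr rfl fun x _ => ?_
  rw [Finset.mul_sum]
  refine Finset.sum_congr rfl fun h _ => ?_
  have ht : Fin.tail ((Fin.consEquiv fun _ => Ω) (x, q)) = q := by
    ext i
    simp [Fin.tail]
  simp only [runAmplitude, ht, Fin.consEquiv_apply, Fin.cons_succ, Fin.cons_zero,
    norm_mul, norm_prod, mul_pow, ← Finset.prod_pow, coherent_norm_sq hD]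
  ring

open Classical in
/-- A median of a list of numbers: an interval that misses it misses at least half of the list. -/
lemma exists_median (l : List ℝ) : ∃ v, ∀ S : Set ℝ, S.OrdConnected → v ∉ S →
    l.length ≤ 2 * l.countP fun e => e ∉ S := by
  -- the median is the least entry `v` such that at least half of the list is at most `v`
  set s := l.toFinset.filter fun x => l.length ≤ 2 * l.countP fun e => e ≤ x with hs
  by_cases hl : l = []
  · exact ⟨0, fun S _ _ => by simp [hl]⟩
  have hlne : l.toFinset.Nonempty := List.toFinset_nonempty_iff _ |>.2 hl
  have hsne : s.Nonempty := by
    refine ⟨l.toFinset.max' hlne, Finset.mem_filter.2 ⟨Finset.max'_mem _ _, ?_⟩⟩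
    have : (l.countP fun e => e ≤ l.toFinset.max' hlne) = l.length :=
      List.countP_eq_length.2 fun e he => by
        simpa using Finset.le_max' _ e (List.mem_toFinset.2 he)
    omega
  set v := s.min' hsne with hv
  have hvP := (Finset.mem_filter.1 (Finset.min'_mem s hsne)).2
  refine ⟨v, fun S hS hvS => ?_⟩
  by_cases hgt : ∀ e ∈ S, v < e
  · refine hvP.trans (Nat.mul_le_mul_left 2 (List.countP_mono_left fun e _ he => ?_))
    have he' : e ≤ v := of_decide_eq_true he
    simpa using fun heS => absurd (hgt e heS) (not_lt.2 he')
  · push Not at hgt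
    obtain ⟨c, hcS, hcv⟩ := hgt
    have hlt : ∀ e ∈ S, e < v := fun e heS => by
      by_contra hev
      exact hvS (hS.out hcS heS ⟨hcv, not_lt.1 hev⟩)
    have h1 : 2 * (l.countP fun e => e < v) ≤ l.length := by
      by_cases ht : (l.toFinset.filter fun e => e < v).Nonempty
      · set w := (l.toFinset.filter fun e => e < v).max' ht with hw
        obtain ⟨hwl, hwv⟩ := Finset.mem_filter.1 (Finset.max'_mem _ ht)
        have hwP : ¬ l.length ≤ 2 * l.countP fun e => e ≤ w := fun h =>
          absurd (Finset.min'_le s w (Finset.mem_filter.2 ⟨hwl, h⟩)) (not_le.2 hwv)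
        have h2 : (l.countP fun e => e < v) ≤ l.countP fun e => e ≤ w :=
          List.countP_mono_left fun e he hev => by
            simpa using Finset.le_max' _ e (Finset.mem_filter.2
              ⟨List.mem_toFinset.2 he, by simpa using hev⟩)
        omega
      · rw [Finset.not_nonempty_iff_eq_empty, Finset.filter_eq_empty_iff] at ht
        have : (l.countP fun e => e < v) = 0 := List.countP_eq_zero.2 fun e he => by
          simpa using ht (List.mem_toFinset.2 he)
        omega
    have h2 := List.length_eq_countP_add_countP (fun e => decide (e < v)) (l := l)
    have h3 : (l.countP fun e => ¬ decide (e < v) = true) ≤ l.countP fun e => e ∉ S :=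
      List.countP_mono_left fun e _ he => by
        have he' : v ≤ e := by simpa using he
        simpa using fun heS => absurd (hlt e heS) (not_lt.2 he')
    omega

open Classical in
/-- `r` independent runs: the first register ends exactly in the state `|ψ_D⟩`, and the number of
bad estimates has a small exponential moment. -/
lemma exists_independent_runs {H : Type} [Fintype H] [DecidableEq H] {h₀ : H} {n T : ℕ}
    {Φ : (Fin n → Ω) → (Ω → ℝ) → Matrix (Ω × H) (Ω × H) ℂ} (hΦ : ∀ q, Implements T (Φ q))
    (est : (Fin n → Ω) → H → ℝ) (r : ℕ) :
    ∃ (e : ℕ) (W : Type) (_ : Fintype W) (_ : DecidableEq W) (w₀ : W)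
      (Ψ : (Ω → ℝ) → Matrix (Ω × ((Fin e → Ω) × W)) (Ω × ((Fin e → Ω) × W)) ℂ)
      (G : (Ω → ℝ) → (Fin e → Ω) × W → ℂ) (out : (Fin e → Ω) × W → List ℝ),
      e = r * (n + 1) ∧ Implements (r * T) Ψ ∧ (∀ z, (out z).length = r) ∧
      (∀ D, Ψ D *ᵥ (fun p => coherent D p.1 *
          ((∏ i, coherent D (p.2.1 i)) * if p.2.2 = w₀ then 1 else 0)) =
        fun p => coherent D p.1 * G D p.2) ∧
      ∀ D ∈ stdSimplex ℝ Ω, ∑ z, ‖G D z‖ ^ 2 = 1 ∧ ∀ S : Set ℝ,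
        ∑ q : Fin n → Ω, (∏ i, D (q i)) * ∑ p : Ω × H, (if est q p.2 ∈ S then 0 else
          ‖(Φ q D *ᵥ fun p => coherent D p.1 * if p.2 = h₀ then 1 else 0) p‖ ^ 2) ≤ 1 / 16 →
        ∑ z, ‖G D z‖ ^ 2 * 16 ^ ((out z).countP fun v => v ∉ S) ≤ 2 ^ r := by
  induction r with
  | zero =>
    refine ⟨0, Unit, inferInstance, inferInstance, (), fun _ => 1, fun _ _ => 1, fun _ => [],
      by simp, ?_, by simp, ?_, ?_⟩
    · rw [zero_mul]
      exact Implements.of_unitary (one_mem _)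
    · intro D
      simp
    · intro D _
      simp
  | succ r ih =>
    obtain ⟨e, W, _, _, w₀, Ψ, G, out, he, hΨ, hlen, hG, hsum⟩ := ih
    set E : (Fin (e + (n + 1)) → Ω) × (W × H) ≃ ((Fin e → Ω) × W) × ((Fin (n + 1) → Ω) × H) :=
      ((Fin.appendEquiv e (n + 1)).symm.prodCongr (Equiv.refl (W × H))).trans
        (Equiv.prodProdProdComm _ _ _ _) with hE
    obtain ⟨Ψ', hΨ', hG'⟩ := exists_append_run (h₀ := h₀) E hΦ hΨ
      (init := fun D z => (∏ i, coherent D (z.1 i)) * if z.2 = w₀ then 1 else 0)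
      (init' := fun D z => (∏ i, coherent D (z.1 i)) * if z.2 = (w₀, h₀) then 1 else 0)
      (by
        rintro D ⟨q₁, w⟩ ⟨q₂, h⟩
        have h1 : E.symm ((q₁, w), (q₂, h)) = (Fin.append q₁ q₂, (w, h)) := rfl
        rw [h1]
        simp only [Fin.prod_univ_add, Fin.append_left, Fin.append_right, Prod.mk.injEq]
        by_cases hw : w = w₀ <;> by_cases hh : h = h₀ <;> simp [hw, hh])
      hG
    refine ⟨e + (n + 1), W × H, inferInstance, inferInstance, (w₀, h₀), Ψ',
      fun D z => G D (E z).1 * runAmplitude h₀ Φ D (E z).2,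
      fun z => est (Fin.tail (E z).2.1) (E z).2.2 :: out (E z).1, by rw [he]; ring, ?_,
      fun z => by simp [hlen], hG', fun D hD => ?_⟩
    · rwa [add_mul, one_mul]
    obtain ⟨h1, hw⟩ := hsum D hD
    have hrun : ∀ q, ∑ p, ‖(Φ q D *ᵥ fun p => coherent D p.1 * if p.2 = h₀ then 1 else 0) p‖ ^ 2 =
        1 := fun q => by
      rw [← l2_sq, l2_mulVec ((hΦ q).mem_unitaryGroup hD), l2_coherent_init hD, one_pow]
    have hD1 : ∑ q : Fin n → Ω, ∏ i, D (q i) = 1 := by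
      rw [sum_prod_pi fun _ x => D x]
      simp [hD.2]
    refine ⟨?_, fun S hS => ?_⟩
    · have h2 := sum_runAmplitude h₀ Φ hD fun _ _ => 1
      simp only [mul_one, hrun, hD1] at h2
      rw [← E.symm.sum_comp, Fintype.sum_prod_type]
      simp only [Equiv.apply_symm_apply, norm_mul, mul_pow, ← Finset.mul_sum]
      rw [h2, ← Finset.sum_mul, h1, one_mul]
    · have h2 := sum_runAmplitude h₀ Φ hD fun q h => if est q h ∈ S then 1 else 16
      have h3 : ∑ b, ‖runAmplitude h₀ Φ D b‖ ^ 2 *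
          (if est (Fin.tail b.1) b.2 ∈ S then 1 else 16) ≤ 2 := by
        rw [h2]
        have h4 : ∀ q : Fin n → Ω, ∑ p : Ω × H,
            ‖(Φ q D *ᵥ fun p => coherent D p.1 * if p.2 = h₀ then 1 else 0) p‖ ^ 2 *
              (if est q p.2 ∈ S then 1 else 16) =
            1 + 15 * ∑ p : Ω × H, (if est q p.2 ∈ S then 0 else
              ‖(Φ q D *ᵥ fun p => coherent D p.1 * if p.2 = h₀ then 1 else 0) p‖ ^ 2) := by
          intro q
          refine Eq.trans ?_ (congrArg (· + 15 * ∑ p : Ω × H, (if est q p.2 ∈ S then 0 else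
              ‖(Φ q D *ᵥ fun p => coherent D p.1 * if p.2 = h₀ then 1 else 0) p‖ ^ 2)) (hrun q))
          rw [Finset.mul_sum, ← Finset.sum_add_distrib]
          refine Finset.sum_congr rfl fun p _ => ?_
          split_ifs <;> ring
        simp only [h4, mul_add, mul_one, Finset.sum_add_distrib, hD1, mul_left_comm _ (15 : ℝ)]
        rw [← Finset.mul_sum]
        linarith
      have h5 : ∀ z b, ‖G D (E (E.symm (z, b))).1 * runAmplitude h₀ Φ D (E (E.symm (z, b))).2‖ ^ 2 *
          16 ^ ((est (Fin.tail (E (E.symm (z, b))).2.1) (E (E.symm (z, b))).2.2 ::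
            out (E (E.symm (z, b))).1).countP fun v => v ∉ S) =
          (‖G D z‖ ^ 2 * 16 ^ ((out z).countP fun v => v ∉ S)) *
            (‖runAmplitude h₀ Φ D b‖ ^ 2 * if est (Fin.tail b.1) b.2 ∈ S then 1 else 16) := by
        intro z b
        rw [Equiv.apply_symm_apply, List.countP_cons, norm_mul, mul_pow]
        by_cases hb : est (Fin.tail b.1) b.2 ∈ S
        · simp [hb]
          ring
        · simp [hb, pow_succ]
          ring
      rw [← E.symm.sum_comp, Fintype.sum_prod_type]
      simp only [h5, ← Finset.mul_sum, ← Finset.sum_mul]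
      rw [pow_succ]
      exact mul_le_mul (hw S hS) h3 (Finset.sum_nonneg fun b _ => by positivity) (by positivity)

/-- Taking the median of `r` runs, each of which fails with probability at most `1/16`, gives an
algorithm that fails with probability at most `2⁻ʳ`. -/
lemma exists_median_algorithm {f : Ω → ℝ} {B ε : ℝ} {H : Type} [Fintype H] [DecidableEq H]
    {h₀ : H} {n T : ℕ}
    {Φ : (Fin n → Ω) → (Ω → ℝ) → Matrix (Ω × H) (Ω × H) ℂ} (hΦ : ∀ q, Implements T (Φ q))
    (est : (Fin n → Ω) → H → ℝ)
    (hfail : open Classical in ∀ D ∈ stdSimplex ℝ Ω, BoundedRelativeVariance D f B →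
      ∑ q : Fin n → Ω, (∏ i, D (q i)) * ∑ p : Ω × H,
        (if IsRelativeEstimate ε (mean D f) (est q p.2) then 0 else
          ‖(Φ q D *ᵥ fun p => coherent D p.1 * if p.2 = h₀ then 1 else 0) p‖ ^ 2) ≤ 1 / 16)
    (r : ℕ) :
    ∃ A : ReflectionAlgorithm Ω, A.copies = r * (n + 1) + 1 ∧ A.queries = r * T ∧
      ∀ D ∈ stdSimplex ℝ Ω, BoundedRelativeVariance D f B →
        1 - (1 / 2) ^ r ≤ A.successProb D (IsRelativeEstimate ε (mean D f)) := by
  classical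
  obtain ⟨e, W, _, _, w₀, Ψ, G, out, he, hΨ, hlen, hG, hsum⟩ :=
    exists_independent_runs (h₀ := h₀) hΦ est r
  choose med hmed using exists_median
  obtain ⟨U, hU⟩ := hΨ.exists_stateAfter w₀ fun z => med (out z)
  refine ⟨⟨e, W, w₀, r * T, U, fun z => med (out z)⟩, congrArg (· + 1) he, rfl,
    fun D hD hBV => ?_⟩
  set A : ReflectionAlgorithm Ω := ⟨e, W, w₀, r * T, U, fun z => med (out z)⟩ with hA
  have hres : ∀ z : A.Outcome, A.residual D z = G D z • coherent D := by
    intro z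
    ext x
    have h1 : A.finalState D = Ψ D *ᵥ A.initialState D := hU (r * T) D
    have h2 : A.initialState D = fun p : Ω × ((Fin e → Ω) × W) => coherent D p.1 *
        ((∏ i, coherent D (p.2.1 i)) * if p.2.2 = w₀ then 1 else 0) := by
      ext p
      simp only [ReflectionAlgorithm.initialState, mul_assoc]
      rfl
    rw [ReflectionAlgorithm.residual, h1, h2, hG]
    simp [mul_comm]
  have hprob : ∀ z : A.Outcome, A.outcomeProb D z = ‖G D z‖ ^ 2 := by
    intro z
    simp only [ReflectionAlgorithm.outcomeProb, hres, Pi.smul_apply, smul_eq_mul, norm_mul, mul_pow]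
    rw [← Finset.mul_sum, coherent_sum_sq hD, mul_one]
  set S : Set ℝ := {v | IsRelativeEstimate ε (mean D f) v} with hS
  have hSc : S.OrdConnected := by
    have : S = Set.Icc (mean D f - ε * mean D f) (mean D f + ε * mean D f) := by
      ext v
      simp only [hS, IsRelativeEstimate, Set.mem_ofPred_eq, abs_le, Set.mem_Icc]
      constructor <;> rintro ⟨h1, h2⟩ <;> constructor <;> linarith
    rw [this]
    exact Set.ordConnected_Icc
  obtain ⟨h1, hw⟩ := hsum D hD
  have hw' := hw S (hfail D hD hBV)
  -- a wrong median means at least `r / 2` wrong estimates, hence a factor `16 ^ (r / 2) = 4 ^ r`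
  have hpt : ∀ z : A.Outcome, ‖G D z‖ ^ 2 -
      (1 / 4) ^ r * (‖G D z‖ ^ 2 * 16 ^ ((out z).countP fun v => v ∉ S)) ≤
        if IsRelativeEstimate ε (mean D f) (A.output z) ∧ A.Restored D z
          then A.outcomeProb D z else 0 := by
    intro z
    have h0 : 0 ≤ ‖G D z‖ ^ 2 := sq_nonneg _
    by_cases hgood : IsRelativeEstimate ε (mean D f) (A.output z)
    · rw [if_pos ⟨hgood, G D z, hres z⟩, hprob]
      have : 0 ≤ (1 / 4 : ℝ) ^ r * (‖G D z‖ ^ 2 * 16 ^ ((out z).countP fun v => v ∉ S)) := by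
        positivity
      linarith
    · rw [if_neg fun h => hgood h.1]
      have h2 := hmed (out z) S hSc hgood
      rw [hlen] at h2
      have h3 : (4 : ℝ) ^ r ≤ 16 ^ ((out z).countP fun v => v ∉ S) := by
        rw [show (16 : ℝ) = 4 ^ 2 by norm_num, ← pow_mul]
        exact pow_le_pow_right₀ (by norm_num) h2
      have h4 : (1 / 4 : ℝ) ^ r * 4 ^ r = 1 := by rw [← mul_pow]; norm_num
      have h5 : 1 ≤ (1 / 4 : ℝ) ^ r * 16 ^ ((out z).countP fun v => v ∉ S) := by
        exact h4.symm.le.trans (mul_le_mul_of_nonneg_left h3 (by positivity))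
      nlinarith
  rw [ReflectionAlgorithm.successProb]
  refine le_trans ?_ (Finset.sum_le_sum fun z _ => hpt z)
  rw [Finset.sum_sub_distrib, ← Finset.mul_sum]
  have h6 : (1 / 4 : ℝ) ^ r * ∑ z, ‖G D z‖ ^ 2 * 16 ^ ((out z).countP fun v => v ∉ S) ≤
      (1 / 2) ^ r := by
    refine (mul_le_mul_of_nonneg_left hw' (by positivity : (0 : ℝ) ≤ (1 / 4) ^ r)).trans
      (le_of_eq ?_)
    rw [← mul_pow]
    norm_num
  refine le_trans ?_ (sub_le_sub_left h6 _)
  exact le_of_eq (by rw [← h1])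

end Amplification

section Parameters

/-! ### The choice of parameters -/

/-- The number of bisection rounds is logarithmic in `1 / ε`. -/
lemma exists_rounds {ε L : ℝ} (hε : 0 < ε) (hε1 : ε < 1) (hL : 1 ≤ L) (hεL : -Real.log ε ≤ L) :
    ∃ N : ℕ, 1 ≤ N ∧ (N : ℝ) ≤ 129 * L ∧ 1024 * (15 / 16) ^ N ≤ ε ∧
      (16 / 15 : ℝ) ^ N ≤ 2048 / ε := by
  have hlog : (1 / 16 : ℝ) ≤ Real.log (16 / 15) := by
    have := Real.one_sub_inv_le_log_of_pos (show (0 : ℝ) < 16 / 15 by norm_num)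
    norm_num at this ⊢
    linarith
  have hlog0 : 0 < Real.log (16 / 15) := by linarith
  have hpow : ∀ M : ℕ, (16 / 15 : ℝ) ^ M = Real.exp (M * Real.log (16 / 15)) := fun M => by
    rw [Real.exp_nat_mul, Real.exp_log (by norm_num)]
  have h1024 : Real.log (1024 / ε) = 10 * Real.log 2 - Real.log ε := by
    rw [Real.log_div (by norm_num) hε.ne', show (1024 : ℝ) = 2 ^ 10 by norm_num, Real.log_pow]
    norm_num
  have hpos : 0 < Real.log (1024 / ε) := Real.log_pos (by rw [lt_div_iff₀ hε]; linarith)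
  have h2 := Real.log_two_lt_d9
  set N := ⌈Real.log (1024 / ε) / Real.log (16 / 15)⌉₊ with hN
  have hle : Real.log (1024 / ε) ≤ N * Real.log (16 / 15) := by
    rw [← div_le_iff₀ hlog0]
    exact Nat.le_ceil _
  have hlt : (N : ℝ) < Real.log (1024 / ε) / Real.log (16 / 15) + 1 :=
    Nat.ceil_lt_add_one (div_pos hpos hlog0).le
  refine ⟨N, Nat.one_le_iff_ne_zero.2 (Nat.ceil_pos.2 (div_pos hpos hlog0)).ne', ?_, ?_, ?_⟩
  · have : Real.log (1024 / ε) / Real.log (16 / 15) ≤ Real.log (1024 / ε) * 16 := by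
      rw [div_le_iff₀ hlog0]
      nlinarith
    linarith
  · have h3 : 1024 / ε ≤ (16 / 15 : ℝ) ^ N := by
      rw [hpow, ← Real.log_le_iff_le_exp (by positivity)]
      exact hle
    rw [show (15 / 16 : ℝ) = (16 / 15)⁻¹ by norm_num, inv_pow, ← div_eq_mul_inv,
      div_le_iff₀ (by positivity)]
    rw [div_le_iff₀ hε] at h3
    linarith
  · have h3 : N * Real.log (16 / 15) ≤ Real.log (1024 / ε) + Real.log (16 / 15) := by
      have := (mul_lt_mul_of_pos_right hlt hlog0).le
      rwa [add_mul, div_mul_cancel₀ _ hlog0.ne', one_mul] at this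
    rw [hpow]
    refine (Real.exp_le_exp.2 h3).trans ?_
    rw [Real.exp_add, Real.exp_log (by positivity), Real.exp_log (by norm_num), div_mul_eq_mul_div]
    exact div_le_div_of_nonneg_right (by norm_num) hε.le

/-- With `O(√N)` qubits per test, the failures of all `N` rounds together are negligible. `O(log N)`
qubits would do, but the bound with the exponent `1.5` leaves room for `√N`. -/
lemma exists_qubits {N : ℕ} (hN : 1 ≤ N) :
    ∃ m : ℕ, (m : ℝ) ≤ 21 * √N ∧ N * √((1 / 2) ^ m) ≤ 1 / 32 := by
  have hN1 : (1 : ℝ) ≤ √N := Real.one_le_sqrt.2 (by exact_mod_cast hN)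
  have hN0 : (0 : ℝ) < N := by exact_mod_cast hN
  refine ⟨⌈20 * √(N : ℝ)⌉₊, ?_, ?_⟩
  · have := Nat.ceil_lt_add_one (show (0 : ℝ) ≤ 20 * √N by positivity)
    linarith
  · set m := ⌈20 * √(N : ℝ)⌉₊ with hm
    have h2 := Real.log_two_gt_d9
    have hx : 13 * √N ≤ m * Real.log 2 := by
      have := Nat.le_ceil (20 * √(N : ℝ))
      nlinarith
    have hexp : (1024 * N ^ 2 : ℝ) ≤ 2 ^ m := by
      have h3 := Real.pow_div_factorial_le_exp (m * Real.log 2) (by positivity) 4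
      rw [Real.exp_nat_mul, Real.exp_log two_pos] at h3
      refine le_trans ?_ h3
      have h4 := pow_le_pow_left₀ (by positivity) hx 4
      have h5 : (13 * √(N : ℝ)) ^ 4 = 28561 * N ^ 2 := by
        rw [mul_pow, show √(N : ℝ) ^ 4 = (√(N : ℝ) ^ 2) ^ 2 by ring, Real.sq_sqrt hN0.le]
        norm_num
      have h6 : ((Nat.factorial 4 : ℕ) : ℝ) = 24 := by norm_num [Nat.factorial]
      rw [h6, le_div_iff₀ (by norm_num)]
      nlinarith
    rw [← le_div_iff₀' hN0]
    refine Real.sqrt_le_iff.2 ⟨by positivity, ?_⟩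
    rw [one_div_pow, div_pow, div_pow, div_div, one_pow]
    refine one_div_le_one_div_of_le (by positivity) ?_
    norm_num
    exact hexp

/-- The number of reflections per qubit in a test with resolution `a`. -/
lemma exists_repetitions {a : ℝ} (ha : 0 < a) (ha1 : a ≤ 1 / 10) :
    ∃ k : ℕ, Real.pi / 2 ≤ k * a ∧ k * a ≤ Real.pi / 2 + 1 / 10 := by
  have hpi := Real.pi_pos
  refine ⟨⌈Real.pi / 2 / a⌉₊, ?_, ?_⟩
  · rw [← div_le_iff₀ ha]
    exact Nat.le_ceil _
  · have := Nat.ceil_lt_add_one (show 0 ≤ Real.pi / 2 / a by positivity)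
    have := (mul_lt_mul_of_pos_right this ha).le
    rw [add_mul, div_mul_cancel₀ _ ha.ne'] at this
    linarith

/-- The resolution improves geometrically, so that the last rounds dominate the number of
reflections. -/
lemma sum_repetitions_le {a₀ : ℝ} (ha : 0 < a₀) {N : ℕ} {k : ℕ → ℕ}
    (hk : ∀ j < N, k j * (a₀ * (15 / 16) ^ j) ≤ Real.pi / 2 + 1 / 10) :
    ∑ j ∈ Finset.range N, (k j : ℝ) ≤ 30 / a₀ * (16 / 15) ^ N := by
  have hpi := Real.pi_lt_d2
  have hkj : ∀ j ∈ Finset.range N, (k j : ℝ) ≤ 2 / a₀ * (16 / 15) ^ j := by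
    intro j hj
    have h1 : (k j : ℝ) ≤ 2 / (a₀ * (15 / 16) ^ j) := by
      rw [le_div_iff₀ (by positivity)]
      linarith [hk j (Finset.mem_range.1 hj)]
    refine h1.trans (le_of_eq ?_)
    rw [show (15 / 16 : ℝ) = (16 / 15)⁻¹ by norm_num, inv_pow, ← div_div, div_inv_eq_mul]
  refine (Finset.sum_le_sum hkj).trans ?_
  rw [← Finset.mul_sum, geom_sum_eq (by norm_num)]
  have h2 : ((16 / 15 : ℝ) ^ N - 1) / (16 / 15 - 1) ≤ 15 * (16 / 15) ^ N := by
    rw [div_le_iff₀ (by norm_num)]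
    have : (0 : ℝ) < (16 / 15) ^ N := by positivity
    linarith
  calc 2 / a₀ * (((16 / 15 : ℝ) ^ N - 1) / (16 / 15 - 1)) ≤ 2 / a₀ * (15 * (16 / 15) ^ N) :=
        mul_le_mul_of_nonneg_left h2 (by positivity)
    _ = 30 / a₀ * (16 / 15) ^ N := by ring

/-- The number of runs of which the median is taken. -/
lemma exists_runs {η : ℝ} (hη : 0 < η) (hη1 : η < 1) :
    ∃ r : ℕ, r * Real.log 2 ≤ Real.log (2 / η) ∧ (1 / 2 : ℝ) ^ r ≤ η := by
  have h2 : 0 < Real.log 2 := Real.log_pos (by norm_num)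
  have hlog : Real.log (2 / η) = Real.log 2 - Real.log η := Real.log_div (by norm_num) hη.ne'
  have hneg := Real.log_neg hη hη1
  refine ⟨⌊Real.log (2 / η) / Real.log 2⌋₊, ?_, ?_⟩
  · rw [← le_div_iff₀ h2]
    exact Nat.floor_le (div_nonneg (by rw [hlog]; linarith) h2.le)
  · set r := ⌊Real.log (2 / η) / Real.log 2⌋₊ with hr
    have h3 := Nat.lt_floor_add_one (Real.log (2 / η) / Real.log 2)
    rw [div_lt_iff₀ h2, ← hr, hlog, add_mul, one_mul] at h3
    have h4 : (1 / 2 : ℝ) ^ r = Real.exp (-(r * Real.log 2)) := by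
      rw [Real.exp_neg, Real.exp_nat_mul, Real.exp_log two_pos, one_div, inv_pow]
    rw [h4, ← Real.le_log_iff_exp_le hη]
    linarith

end Parameters

end QMean

theorem theorem3p6 :
    ∃ K : ℝ, 0 < K ∧
      ∀ (Ω : Type*) [Fintype Ω] [DecidableEq Ω] (f : Ω → ℝ) (B ε η : ℝ),
        (∀ x, 0 ≤ f x) → 1 ≤ B → 0 < ε → ε < 1 → 0 < η → η < 1 →
        ∃ A : QMean.ReflectionAlgorithm Ω,
          (A.copies : ℝ) ≤ 16 * B * Real.log (2 / η) + 1 ∧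
          (A.queries : ℝ) ≤
            K * (Real.sqrt B / ε * max 1 (Real.log (B / ε)) ^ (3 / 2 : ℝ) *
              max 1 (Real.log (max 1 (Real.log (B / ε)) / η))) ∧
          ∀ D ∈ stdSimplex ℝ Ω, QMean.BoundedRelativeVariance D f B →
            1 - η ≤ A.successProb D (QMean.IsRelativeEstimate ε (QMean.mean D f)) := by
  refine ⟨2 * 10 ^ 12, by norm_num, ?_⟩
  intro Ω _ _ f B ε η hf hB hε hε1 hη hη1
  set L := max 1 (Real.log (B / ε)) with hL
  set Y := max 1 (Real.log (L / η)) with hY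
  have hL1 : 1 ≤ L := le_max_left _ _
  have hY1 : 1 ≤ Y := le_max_left _ _
  have hB0 : 0 < B := by linarith
  have hsB : 0 < √B := Real.sqrt_pos.2 hB0
  have hsB1 : 1 ≤ √B := Real.one_le_sqrt.2 hB
  have hεL : -Real.log ε ≤ L := by
    refine le_trans ?_ (le_max_right _ _)
    rw [Real.log_div hB0.ne' hε.ne']
    linarith [Real.log_nonneg hB]
  have hηY : -Real.log η ≤ Y := by
    refine le_trans ?_ (le_max_right _ _)
    rw [Real.log_div (by linarith) hη.ne']
    linarith [Real.log_nonneg hL1]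
  obtain ⟨N, hN1, hNL, hNε, hN2⟩ := QMean.exists_rounds hε hε1 hL1 hεL
  obtain ⟨m, hmN, hm⟩ := QMean.exists_qubits hN1
  obtain ⟨r, hr, hrη⟩ := QMean.exists_runs hη hη1
  have hN1' : (1 : ℝ) ≤ N := by exact_mod_cast hN1
  have hN0 : (0 : ℝ) < N := by linarith
  -- the accuracy of the eigenvector in each of the `N` rounds
  set s : ℝ := 1 / (200 * N) with hs
  have hs0 : 0 < s := by positivity
  have hs1 : s ≤ 1 / 10 := one_div_le_one_div_of_le (by norm_num) (by linarith)
  have hsN : N * (6 * s) = 3 / 100 := by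
    rw [hs]
    field_simp
    norm_num
  have ha : 0 < s / √B := by positivity
  have ha1 : ∀ j : ℕ, s / √B * (15 / 16) ^ j ≤ 1 / 10 := fun j =>
    (mul_le_of_le_one_right ha.le (pow_le_one₀ (by norm_num) (by norm_num))).trans
      ((div_le_self hs0.le hsB1).trans hs1)
  choose k hk using fun j : ℕ =>
    QMean.exists_repetitions (show 0 < s / √B * (15 / 16) ^ j by positivity) (ha1 j)
  have hn := Nat.le_ceil (9 * B)
  have hn' := Nat.ceil_lt_add_one (show 0 ≤ 9 * B by positivity)
  set n := ⌈9 * B⌉₊ with hnd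
  obtain ⟨H, _, _, h₀, Φ, est, hΦ, hfail⟩ := QMean.exists_run f (m := m) hf hB hn hs0 hs1
    (fun j (_ : j < N) => hk j) hNε (by rw [mul_add, hsN]; linarith)
  obtain ⟨A, hcopies, hqueries, hA⟩ := QMean.exists_median_algorithm hΦ est hfail r
  have hr0 : (0 : ℝ) ≤ r := Nat.cast_nonneg r
  have hlog2 := Real.log_two_gt_d9
  refine ⟨A, ?_, ?_, fun D hD hBV => le_trans (by linarith) (hA D hD hBV)⟩
  · rw [hcopies]
    push_cast
    have h1 : (r : ℝ) * (n + 1) ≤ r * (11 * B) := mul_le_mul_of_nonneg_left (by linarith) hr0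
    have h2 : (r : ℝ) * 11 ≤ 16 * Real.log (2 / η) := by nlinarith
    nlinarith
  · rw [hqueries]
    push_cast
    have hsum := QMean.sum_repetitions_le ha (fun j (_ : j < N) => (hk j).2)
    have hT : ∑ j ∈ Finset.range N, ((m : ℝ) * k j) ≤
        (240 * √L) * (129 * L) * (12288000 * (√B / ε)) := by
      rw [← Finset.mul_sum]
      have h1 : 30 / (s / √B) * (16 / 15 : ℝ) ^ N ≤ N * (12288000 * (√B / ε)) := by
        have : 30 / (s / √B) = 6000 * N * √B := by
          rw [hs]
          field_simp
          norm_num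
        rw [this]
        calc 6000 * N * √B * (16 / 15 : ℝ) ^ N ≤ 6000 * N * √B * (2048 / ε) :=
              mul_le_mul_of_nonneg_left hN2 (by positivity)
          _ = N * (12288000 * (√B / ε)) := by ring
      have h2 : (m : ℝ) ≤ 240 * √L := by
        have h3 : √(N : ℝ) ≤ √(129 * L) := Real.sqrt_le_sqrt hNL
        have h4 : √(129 * L) ≤ 80 / 7 * √L := by
          rw [Real.sqrt_mul (by norm_num)]
          refine mul_le_mul_of_nonneg_right ?_ (Real.sqrt_nonneg _)
          exact Real.sqrt_le_iff.2 ⟨by norm_num, by norm_num⟩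
        linarith
      calc (m : ℝ) * ∑ j ∈ Finset.range N, (k j : ℝ)
          ≤ (240 * √L) * (129 * L * (12288000 * (√B / ε))) :=
            mul_le_mul h2 (hsum.trans (h1.trans (mul_le_mul_of_nonneg_right hNL (by positivity))))
              (Finset.sum_nonneg fun j _ => Nat.cast_nonneg _) (by positivity)
        _ = _ := by ring
    have hrY : (r : ℝ) ≤ 3 * Y := by
      rw [Real.log_div (by norm_num) hη.ne'] at hr
      have := Real.log_two_lt_d9
      nlinarith
    have hL32 : L ^ (3 / 2 : ℝ) = L * √L := by
      rw [show (3 / 2 : ℝ) = 1 + 1 / 2 by norm_num, Real.rpow_add (by linarith), Real.rpow_one,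
        Real.sqrt_eq_rpow]
    rw [hL32]
    have hQ : 0 ≤ √B / ε * (L * √L) * Y := by positivity
    calc (r : ℝ) * ∑ j ∈ Finset.range N, ((m : ℝ) * k j)
        ≤ (3 * Y) * ((240 * √L) * (129 * L) * (12288000 * (√B / ε))) :=
          mul_le_mul hrY hT (Finset.sum_nonneg fun j _ => by positivity) (by positivity)
      _ = 1141309440000 * (√B / ε * (L * √L) * Y) := by ring
      _ ≤ 2 * 10 ^ 12 * (√B / ε * (L * √L) * Y) :=
          mul_le_mul_of_nonneg_right (by norm_num) hQ
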